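/- **Setting.** Let $N_L\ge 1$ and let $m_\ell,n_\ell,r_\ell$ ($1\le \ell\le N_L$) be integers with $1\le r_\ell\le\min\{m_\ell,n_\ell\}$. A parameter vector $x\in\mathbb{R}^d$, $d=\sum_\ell m_\ell n_\ell$, collects the entries of weight matrices $X_\ell\in\mathbb{R}^{m_\ell\times n_\ell}$; $\nabla_\ell$ denotes the gradient with respect to $X_\ell$. Let $f(x)=\mathbb{E}_{\xi\sim\mathcal D}F(x;\xi)$ and assume: (i) $\inf_x f(x)>-\infty$; (ii) $f$ is differentiable and $\|\nabla f(x)-\nabla f(y)\|_2\le L\|x-y\|_2$ for all $x,y$, where $L>0$; (iii) for all $x$ and $\ell$, $\mathbb{E}_{\xi\sim\mathcal D}[\nabla_\ell F(x;\xi)]=\nabla_\ell f(x)$ and $\mathbb{E}_{\xi\sim\mathcal D}\|\nabla_\ell F(x;\xi)-\nabla_\ell f(x)\|_F^2\le\sigma_\ell^2$. Put $\sigma=\sqrt{\sum_\ell\sigma_\ell^2}$, $\underline\delta=\min_\ell \frac{r_\ell}{\min\{m_\ell,n_\ell\}}$ and $\Delta=f(x^{(0)})-\inf_x f(x)$. **Algorithm**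 (GoLore with small-batch stochastic gradients, momentum SGD and momentum projection; inputs $x^{(0)},\beta_1,\tau,\eta$). Let $\mathcal U(\mathrm{St}_{a,b})$ be the uniform (orthogonally invariant) distribution on $\mathrm{St}_{a,b}=\{P\in\mathbb{R}^{a\times b}: P^\top P=I_b\}$. Set $M_\ell^{(-1)}=0$. For $t=0,1,2,\dots$ draw $\xi^{(t)}\sim\mathcal D$ and let $G_\ell^{(t)}=\nabla_\ell F(x^{(t)};\xi^{(t)})$. For each $\ell$ with $m_\ell\le n_\ell$: if $\tau\mid t$, draw $P_\ell^{(t)}\sim\mathcal U(\mathrm{St}_{m_\ell,r_\ell})$ and set $M_\ell^{(t)}=(1-\beta_1)(P_\ell^{(t)})^\top P_\ell^{(t-1)}M_\ell^{(t-1)}+\beta_1(P_\ell^{(t)})^\top G_\ell^{(t)}$; otherwise set $P_\ell^{(t)}=P_\ell^{(t-1)}$ and $M_\ell^{(t)}=(1-\beta_1)M_\ell^{(t-1)}+\beta_1(P_\ell^{(t)})^\top G_\ell^{(t)}$; then $X_\ell^{(t+1)}=X_\ell^{(t)}-\eta P_\ell^{(t)}M_\ell^{(t)}$. For each $\ell$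 with $m_\ell>n_\ell$: if $\tau\mid t$, draw $Q_\ell^{(t)}\sim\mathcal U(\mathrm{St}_{n_\ell,r_\ell})$ and set $M_\ell^{(t)}=(1-\beta_1)M_\ell^{(t-1)}(Q_\ell^{(t-1)})^\top Q_\ell^{(t)}+\beta_1 G_\ell^{(t)}Q_\ell^{(t)}$; otherwise set $Q_\ell^{(t)}=Q_\ell^{(t-1)}$ and $M_\ell^{(t)}=(1-\beta_1)M_\ell^{(t-1)}+\beta_1 G_\ell^{(t)}Q_\ell^{(t)}$; then $X_\ell^{(t+1)}=X_\ell^{(t)}-\eta M_\ell^{(t)}(Q_\ell^{(t)})^\top$. All draws are independent. (At $t=0$ the term with $M_\ell^{(-1)}$ is zero.) **Theorem.** There is an absolute constant $C>0$ such that in every such setting the following hold, with all expectations finite. 1. If $$0<\beta_1\le1,\qquad \tau\ge\frac{64}{3\beta_1\underline\delta},\qquad 0<\eta\le\min\left\{\frac1{4L},\sqrt{\frac{3\underline\delta\beta_1^2}{80L^2}},\sqrt{\frac{3\underline\delta}{80\tau^2L^2}},\sqrt{\frac{3\beta_1}{16\tau L^2}}\right\}$$ with $\tau$ an integer, then for every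 integer $K\ge1$ $$\frac1{K\tau}\sum_{t=0}^{K\tau-1}\mathbb{E}\|\nabla f(x^{(t)})\|_2^2\le\frac{16\Delta}{\underline\delta\,\eta K\tau}+\frac{32\beta_1\sigma^2}{3\underline\delta}.$$ 2. If $\Delta>0$, then for every integer $T\ge 2+\frac{128}{3\underline\delta}+\frac{(128\sigma)^2}{9\sqrt{\underline\delta}L\Delta}$, with the choice $$\beta_1=\left(1+\sqrt{\frac{\underline\delta^{3/2}\sigma^2T}{L\Delta}}\right)^{-1},\quad \tau=\left\lceil\frac{64}{3\underline\delta\beta_1}\right\rceil,\quad \eta=\left(4L+\sqrt{\frac{80L^2}{3\underline\delta\beta_1^2}}+\sqrt{\frac{80\tau^2L^2}{3\underline\delta}}+\sqrt{\frac{16\tau L^2}{3\beta_1}}\right)^{-1},$$ $$\frac1T\sum_{t=0}^{T-1}\mathbb{E}\|\nabla f(x^{(t)})\|_2^2\le C\left(\frac{L\Delta}{\underline\delta^{5/2}T}+\sqrt{\frac{L\Delta\sigma^2}{\underline\delta^{7/2}T}}\right).$$ 3. Consequently, if $\Delta>0$, then for every $\varepsilon>0$ there is an integer $T_0\le C\left(\frac{L\Delta\sigma^2}{\underline\delta^{7/2}\varepsilon^2}+\frac{L\Delta}{\underline\delta^{5/2}\varepsilon}+\frac{\sigma^2}{\underline\delta^{1/2}L\Delta}+\frac1{\underline\delta}\right)$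 such that every integer $T\ge T_0$ satisfies the lower bound on $T$ in 2, and $T$ iterations (one stochastic gradient each) with the choice in 2 give $\frac1T\sum_{t=0}^{T-1}\mathbb{E}\|\nabla f(x^{(t)})\|_2^2\le\varepsilon$. -/

import Mathlib

open MeasureTheory ProbabilityTheory

noncomputable section

namespace GoLore

/-! ### The Stiefel manifold and its uniform distribution -/

/-- Real matrices carry the product (that is, Borel) σ-algebra. -/
instance instMeasurableSpaceMatrix {a b : Type*} : MeasurableSpace (Matrix a b ℝ) :=
  inferInstanceAs (MeasurableSpace (a → b → ℝ))

instance instBorelSpaceMatrix {a b : Type*} [Countable a] [Countable b] :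
    BorelSpace (Matrix a b ℝ) :=
  inferInstanceAs (BorelSpace (a → b → ℝ))

instance instCompactSpaceOrthogonalGroup (k : ℕ) :
    CompactSpace (Matrix.orthogonalGroup (Fin k) ℝ) := by
  let K : Set (Matrix (Fin k) (Fin k) ℝ) :=
    Set.pi Set.univ fun _ => Set.pi Set.univ fun _ => Set.Icc (-1 : ℝ) 1
  have hK : IsCompact K :=
    isCompact_univ_pi fun _ => isCompact_univ_pi fun _ => isCompact_Icc
  have hsub : ((Matrix.orthogonalGroup (Fin k) ℝ : Submonoid _) :
      Set (Matrix (Fin k) (Fin k) ℝ)) ⊆ K := by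
    intro U hU i _ j _
    have h := entry_norm_bound_of_unitary (𝕜 := ℝ) hU i j
    exact abs_le.mp h
  have hcl : IsClosed ((Matrix.orthogonalGroup (Fin k) ℝ : Submonoid _) :
      Set (Matrix (Fin k) (Fin k) ℝ)) := by
    have : ((Matrix.orthogonalGroup (Fin k) ℝ : Submonoid _) :
        Set (Matrix (Fin k) (Fin k) ℝ)) = {U | U * U.transpose = 1} := by
      ext U
      exact Matrix.mem_orthogonalGroup_iff (Fin k) ℝ
    rw [this]
    exact isClosed_eq (by fun_prop) continuous_const
  exact isCompact_iff_compactSpace.mp (hK.of_isClosed_subset hcl hsub)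

/-- The first `b` columns of an `a × a` matrix `U`, written as `U * J`, where `J` is the `a × b`
matrix with ones on its main diagonal and zeros elsewhere. -/
def firstColumns {a : ℕ} (b : ℕ) (U : Matrix (Fin a) (Fin a) ℝ) : Matrix (Fin a) (Fin b) ℝ :=
  U * (Matrix.of fun i j => if (i : ℕ) = (j : ℕ) then 1 else 0 : Matrix (Fin a) (Fin b) ℝ)

/-- The uniform distribution on the Stiefel manifold `{P : P.transpose * P = 1}` of `a × b`
matrices, `b ≤ a`: the law of the first `b` columns of a Haar-distributed random orthogonal
`a × a` matrix. It is the only probability measure on the Stiefel manifold that is invariant under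
`P ↦ O * P` for all orthogonal `O`. -/
def stiefelUniform (a b : ℕ) : Measure (Matrix (Fin a) (Fin b) ℝ) :=
  Measure.map (fun U : Matrix.orthogonalGroup (Fin a) ℝ => firstColumns b U.1)
    (Measure.haarMeasure
      (⊤ : TopologicalSpace.PositiveCompacts (Matrix.orthogonalGroup (Fin a) ℝ)))

/-! ### Parameters and gradient oracle -/

variable {N : ℕ} {m n r : Fin N → ℕ}

/-- The parameter vector `x` that collects the entries of all weight matrices
`X_ℓ ∈ ℝ^(m_ℓ × n_ℓ)`, with the Euclidean norm. -/
abbrev Params (m n : Fin N → ℕ) : Type :=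
  EuclideanSpace ℝ (Σ ℓ : Fin N, Fin (m ℓ) × Fin (n ℓ))

/-- The `ℓ`-th weight matrix of a parameter vector. Applied to a gradient, it gives the gradient
with respect to the `ℓ`-th weight matrix. -/
def block (x : Params m n) (ℓ : Fin N) : Matrix (Fin (m ℓ)) (Fin (n ℓ)) ℝ :=
  Matrix.of fun i j => x ⟨ℓ, i, j⟩

/-- The parameter vector with given weight matrices. -/
def assemble (X : ∀ ℓ, Matrix (Fin (m ℓ)) (Fin (n ℓ)) ℝ) : Params m n :=
  WithLp.toLp 2 fun p => X p.1 p.2.1 p.2.2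

/-- The square of the Frobenius norm. -/
def frobSq {a b : ℕ} (A : Matrix (Fin a) (Fin b) ℝ) : ℝ := ∑ i, ∑ j, A i j ^ 2

/-- The stochastic gradient `∇F(x; ξ)` (the gradient is in `x`). -/
def stochGrad {Ξ : Type*} (F : Params m n → Ξ → ℝ) (x : Params m n) (ξ : Ξ) : Params m n :=
  gradient (fun y => F y ξ) x

/-- The objective `f(x) = 𝔼_{ξ ∼ D} F(x; ξ)`. -/
def objective {Ξ : Type*} [MeasurableSpace Ξ] (F : Params m n → Ξ → ℝ) (D : Measure Ξ)
    (x : Params m n) : ℝ := ∫ ξ, F x ξ ∂D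

/-- `f` is differentiable with `L`-Lipschitz gradient. -/
def LSmooth (f : Params m n → ℝ) (L : ℝ) : Prop :=
  Differentiable ℝ f ∧ ∀ x y, ‖gradient f x - gradient f y‖ ≤ L * ‖x - y‖

/-- The standing assumption on the gradient oracle `(F, D)`: the stochastic gradient is unbiased
and its `ℓ`-th block has variance at most `σ_ℓ²`. The first three fields and the integrability
fields say that the loss, its gradient and the expectations in question make sense. -/
structure StochasticGradient {Ξ : Type*} [MeasurableSpace Ξ] (F : Params m n → Ξ → ℝ)
    (D : Measure Ξ) (σ : Fin N → ℝ) : Prop where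
  integrable_loss : ∀ x, Integrable (F x) D
  differentiable : ∀ x, ∀ᵐ ξ ∂D, DifferentiableAt ℝ (fun y => F y ξ) x
  measurable_grad : Measurable fun p : Params m n × Ξ => stochGrad F p.1 p.2
  integrable_grad : ∀ x, Integrable (stochGrad F x) D
  unbiased : ∀ x, ∫ ξ, stochGrad F x ξ ∂D = gradient (objective F D) x
  integrable_sq : ∀ x ℓ, Integrable
    (fun ξ => frobSq (block (stochGrad F x ξ) ℓ - block (gradient (objective F D) x) ℓ)) D
  variance_le : ∀ x ℓ,
    ∫ ξ, frobSq (block (stochGrad F x ξ) ℓ - block (gradient (objective F D) x) ℓ) ∂D ≤ σ ℓ ^ 2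

/-- `σ = √(∑ σ_ℓ²)`. -/
def totalSigma (σ : Fin N → ℝ) : ℝ := √(∑ ℓ, σ ℓ ^ 2)

/-- `δ = min_ℓ r_ℓ / min (m_ℓ, n_ℓ)` (for `N ≥ 1`). -/
def minDelta (m n r : Fin N → ℕ) : ℝ := ⨅ ℓ, (r ℓ : ℝ) / (min (m ℓ) (n ℓ) : ℕ)

/-- `Δ = f(x⁰) - inf f`. -/
def gap (f : Params m n → ℝ) (x₀ : Params m n) : ℝ := f x₀ - ⨅ x, f x

/-! ### The algorithm -/

/-- From matrices `S 0, S 1, …` the one in use at time `t`: it is refreshed at the times divisible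
by `τ` and kept otherwise. -/
def held {α : Type*} (τ : ℕ) (S : ℕ → α) : ℕ → α
  | 0 => S 0
  | t + 1 => if τ ∣ t + 1 then S (t + 1) else held τ S t

/-- The iterate `x^(t)`, together with the momenta `M_ℓ^(t-1)`. The momentum of a layer `ℓ` with
`m_ℓ ≤ n_ℓ` is the `r_ℓ × n_ℓ` matrix `left ℓ`, that of a layer with `m_ℓ > n_ℓ` is the
`m_ℓ × r_ℓ` matrix `right ℓ`. The other component of each layer is not used. -/
structure State (m n r : Fin N → ℕ) where
  x : Params m n
  left : ∀ ℓ, Matrix (Fin (r ℓ)) (Fin (n ℓ)) ℝ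
  right : ∀ ℓ, Matrix (Fin (m ℓ)) (Fin (r ℓ)) ℝ

/-- One iteration, at time `t`, of momentum SGD with momentum projection in the subspaces given by
`P`, `Q` (those of time `t`) and `P'`, `Q'` (those of time `t - 1`), with stochastic gradient `G`.
-/
def step (β η : ℝ) (τ t : ℕ)
    (P P' : ∀ ℓ, Matrix (Fin (m ℓ)) (Fin (r ℓ)) ℝ)
    (Q Q' : ∀ ℓ, Matrix (Fin (n ℓ)) (Fin (r ℓ)) ℝ)
    (G : Params m n) (s : State m n r) : State m n r :=
  let left : ∀ ℓ, Matrix (Fin (r ℓ)) (Fin (n ℓ)) ℝ := fun ℓ =>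
    (1 - β) • (if τ ∣ t then (P ℓ).transpose * P' ℓ * s.left ℓ else s.left ℓ)
      + β • ((P ℓ).transpose * block G ℓ)
  let right : ∀ ℓ, Matrix (Fin (m ℓ)) (Fin (r ℓ)) ℝ := fun ℓ =>
    (1 - β) • (if τ ∣ t then s.right ℓ * (Q' ℓ).transpose * Q ℓ else s.right ℓ)
      + β • (block G ℓ * Q ℓ)
  { x := assemble fun ℓ =>
      if m ℓ ≤ n ℓ then block s.x ℓ - η • (P ℓ * left ℓ)
      else block s.x ℓ - η • (right ℓ * (Q ℓ).transpose)
    left := left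
    right := right }

/-- The run of GoLore (small-batch stochastic gradients, momentum SGD with momentum projection)
from `x₀`, on the data points `ξ 0, ξ 1, …` and the sampled projection matrices `P t ℓ`, `Q t ℓ`
(of which only those with `τ ∣ t` are used). At `t = 0` the momenta are zero, so that the
projections "of time `-1`" are irrelevant. -/
def run {Ξ : Type*} (F : Params m n → Ξ → ℝ) (β η : ℝ) (τ : ℕ) (x₀ : Params m n) (ξ : ℕ → Ξ)
    (P : ℕ → ∀ ℓ, Matrix (Fin (m ℓ)) (Fin (r ℓ)) ℝ)
    (Q : ℕ → ∀ ℓ, Matrix (Fin (n ℓ)) (Fin (r ℓ)) ℝ) : ℕ → State m n r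
  | 0 => ⟨x₀, 0, 0⟩
  | t + 1 =>
    let s := run F β η τ x₀ ξ P Q t
    step β η τ t (held τ P t) (held τ P (t - 1)) (held τ Q t) (held τ Q (t - 1))
      (stochGrad F s.x (ξ t)) s

/-- The random inputs of the algorithm: data points `ξ_t ∼ D` and projection matrices
`P_{t,ℓ}`, `Q_{t,ℓ}` uniform on their Stiefel manifolds. The data points are independent, the pairs
`(P_{t,ℓ}, Q_{t,ℓ})` are independent, and the data points are independent of the projections. -/
structure Sampling {Ω Ξ : Type*} [MeasurableSpace Ω] [MeasurableSpace Ξ] (μ : Measure Ω)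
    (D : Measure Ξ) (ξ : ℕ → Ω → Ξ)
    (P : ℕ → ∀ ℓ, Ω → Matrix (Fin (m ℓ)) (Fin (r ℓ)) ℝ)
    (Q : ℕ → ∀ ℓ, Ω → Matrix (Fin (n ℓ)) (Fin (r ℓ)) ℝ) : Prop where
  measurable_data : ∀ t, Measurable (ξ t)
  law_data : ∀ t, μ.map (ξ t) = D
  measurable_left : ∀ t ℓ, Measurable (P t ℓ)
  law_left : ∀ t ℓ, μ.map (P t ℓ) = stiefelUniform (m ℓ) (r ℓ)
  measurable_right : ∀ t ℓ, Measurable (Q t ℓ)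
  law_right : ∀ t ℓ, μ.map (Q t ℓ) = stiefelUniform (n ℓ) (r ℓ)
  indep_data : iIndepFun ξ μ
  indep_proj : iIndepFun (fun (i : ℕ × Fin N) ω => (P i.1 i.2 ω, Q i.1 i.2 ω)) μ
  indep_data_proj : IndepFun (fun ω t => ξ t ω)
    (fun ω (i : ℕ × Fin N) => (P i.1 i.2 ω, Q i.1 i.2 ω)) μ

/-- The random iterate `x^(t)` of GoLore. -/
def iterate {Ω Ξ : Type*} (F : Params m n → Ξ → ℝ) (β η : ℝ) (τ : ℕ) (x₀ : Params m n)
    (ξ : ℕ → Ω → Ξ)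
    (P : ℕ → ∀ ℓ, Ω → Matrix (Fin (m ℓ)) (Fin (r ℓ)) ℝ)
    (Q : ℕ → ∀ ℓ, Ω → Matrix (Fin (n ℓ)) (Fin (r ℓ)) ℝ) (t : ℕ) (ω : Ω) : Params m n :=
  (run F β η τ x₀ (fun s => ξ s ω) (fun s ℓ => P s ℓ ω) (fun s ℓ => Q s ℓ ω) t).x

/-! ### The hyperparameters for a horizon of `T` iterations -/

/-- `β₁ = (1 + √(δ^{3/2} σ² T / (L Δ)))⁻¹`. -/
def betaT (δ σ L Δ : ℝ) (T : ℕ) : ℝ := (1 + √(δ ^ (3 / 2 : ℝ) * σ ^ 2 * T / (L * Δ)))⁻¹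

/-- `τ = ⌈64 / (3 δ β₁)⌉`. -/
def tauT (δ σ L Δ : ℝ) (T : ℕ) : ℕ := ⌈64 / (3 * δ * betaT δ σ L Δ T)⌉₊

/-- `η = (4L + √(80L²/(3δβ₁²)) + √(80τ²L²/(3δ)) + √(16τL²/(3β₁)))⁻¹`. -/
def etaT (δ σ L Δ : ℝ) (T : ℕ) : ℝ :=
  (4 * L + √(80 * L ^ 2 / (3 * δ * betaT δ σ L Δ T ^ 2))
    + √(80 * (tauT δ σ L Δ T : ℝ) ^ 2 * L ^ 2 / (3 * δ))
    + √(16 * (tauT δ σ L Δ T : ℝ) * L ^ 2 / (3 * betaT δ σ L Δ T)))⁻¹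

end GoLore

end

open GoLore

/-!
Seen in the full parameter space, the momentum of GoLore is `A_t ((1 - β) M + β G)`, where `A_t` is
the orthogonal projection onto the current subspaces; changing subspaces just projects the momentum
once more. A uniform projection of rank `r` in dimension `a` has second moment `(r / a) • 1` and is
independent of the past, so at the start of each period at least the fraction `δ` of the gradient
survives in expectation, and by smoothness at least `δ / 2` survives, up to the distance travelled,
until the next refresh. The momentum estimates the projected gradient with an error that contracts
by `1 - β` per step and picks up the discarded part of the gradient only at a refresh, which the
lower bound on the period makes affordable. The descent lemma bounds the decrease of the loss
through this error and the discarded part, and its negative multiple of the squared step length pays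
for the distances travelled; summing over the periods gives the averaged bound. The hyperparameters
for a horizon `T` balance its two terms.
-/

namespace GoLore

open scoped Matrix

/-! ### Second moments of the uniform distribution on the Stiefel manifold -/

/-- The Haar probability measure on the orthogonal group `O(a)`, of which `stiefelUniform a b` is
the image. -/
noncomputable abbrev orthogonalHaar (a : ℕ) : Measure (Matrix.orthogonalGroup (Fin a) ℝ) :=
  Measure.haarMeasure ⊤

instance (a : ℕ) : IsProbabilityMeasure (orthogonalHaar a) :=
  ⟨Measure.haarMeasure_self (K₀ := ⊤)⟩

lemma integrable_orthogonalHaar_of_continuous {a : ℕ} {g : Matrix.orthogonalGroup (Fin a) ℝ → ℝ}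
    (hg : Continuous g) : Integrable g (orthogonalHaar a) :=
  hg.integrable_of_hasCompactSupport (.of_compactSpace g)

lemma integrable_entry_mul_entry {a : ℕ} (i j k l : Fin a) :
    Integrable (fun U => U.1 i k * U.1 j l) (orthogonalHaar a) :=
  integrable_orthogonalHaar_of_continuous
    ((continuous_subtype_val.matrix_elem i k).mul (continuous_subtype_val.matrix_elem j l))

/-- Flipping the sign of row `i` preserves the Haar measure. -/
lemma integral_entry_mul_entry_of_row_ne {a : ℕ} {i j : Fin a} (hij : i ≠ j) (k l : Fin a) :
    ∫ U, U.1 i k * U.1 j l ∂(orthogonalHaar a) = 0 := by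
  let d : Fin a → ℝ := Function.update 1 i (-1)
  have hd : ∀ p, d p * d p = 1 := fun p => by
    obtain rfl | hp := eq_or_ne p i <;> simp [d, *]
  let flip : Matrix.orthogonalGroup (Fin a) ℝ := ⟨Matrix.diagonal d, by
    simp [Matrix.mem_orthogonalGroup_iff, hd]⟩
  have hflip : ∀ U : Matrix.orthogonalGroup (Fin a) ℝ,
      (flip * U).1 i k * (flip * U).1 j l = -(U.1 i k * U.1 j l) := fun U => by
    simp [flip, Matrix.diagonal_mul, d, hij.symm]
  have hinv := integral_mul_left_eq_self (μ := orthogonalHaar a) (fun U => U.1 i k * U.1 j l) flip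
  simp only [hflip, integral_neg] at hinv
  linarith

lemma integral_entry_sq_row_eq {a : ℕ} (i j k : Fin a) :
    ∫ U, U.1 i k ^ 2 ∂(orthogonalHaar a) = ∫ U, U.1 j k ^ 2 ∂(orthogonalHaar a) := by
  let swap : Matrix.orthogonalGroup (Fin a) ℝ := ⟨(Equiv.swap i j).permMatrix ℝ, by
    rw [Matrix.mem_orthogonalGroup_iff, Matrix.transpose_permMatrix, ← Matrix.permMatrix_mul,
      inv_mul_cancel, Matrix.permMatrix_one]⟩
  have hswap : ∀ U : Matrix.orthogonalGroup (Fin a) ℝ, (swap * U).1 i k = U.1 j k := fun U => by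
    simp [swap, PEquiv.toMatrix_toPEquiv_mul]
  simpa only [hswap] using
    (integral_mul_left_eq_self (μ := orthogonalHaar a) (fun U => U.1 i k ^ 2) swap).symm

lemma integral_entry_sq {a : ℕ} (i k : Fin a) :
    ∫ U, U.1 i k ^ 2 ∂(orthogonalHaar a) = 1 / a := by
  have : NeZero a := ⟨(Fin.pos i).ne'⟩
  have hcol : ∀ U : Matrix.orthogonalGroup (Fin a) ℝ, ∑ l, U.1 l k ^ 2 = 1 := fun U => by
    have h := congrFun₂ ((Matrix.mem_orthogonalGroup_iff' (Fin a) ℝ).1 U.2) k k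
    simpa [Matrix.mul_apply, ← sq] using h
  have hsum : ∑ l, ∫ U, U.1 l k ^ 2 ∂(orthogonalHaar a) = 1 := by
    rw [← integral_finsetSum _ fun l _ => by
      simpa only [sq] using integrable_entry_mul_entry l l k k]
    simp [hcol]
  rw [Finset.sum_congr rfl fun l _ => integral_entry_sq_row_eq l i k, Finset.sum_const,
    Finset.card_univ, Fintype.card_fin, nsmul_eq_mul] at hsum
  rwa [eq_div_iff (NeZero.ne _), mul_comm]

lemma measurable_firstColumns (a b : ℕ) :
    Measurable fun U : Matrix.orthogonalGroup (Fin a) ℝ => firstColumns b U.1 := by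
  refine Continuous.measurable ?_
  unfold firstColumns
  fun_prop

instance (a b : ℕ) : IsProbabilityMeasure (stiefelUniform a b) :=
  Measure.isProbabilityMeasure_map (measurable_firstColumns a b).aemeasurable

lemma firstColumns_apply {a b : ℕ} (h : b ≤ a) (U : Matrix (Fin a) (Fin a) ℝ) (i : Fin a)
    (j : Fin b) : firstColumns b U i j = U i (Fin.castLE h j) := by
  have hJ : ∀ k : Fin a, (k : ℕ) = j ↔ k = Fin.castLE h j := fun k => by simp [Fin.ext_iff]
  simp [firstColumns, Matrix.mul_apply, hJ]

lemma transpose_mul_firstColumns {a b : ℕ} (h : b ≤ a) (U : Matrix.orthogonalGroup (Fin a) ℝ) :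
    (firstColumns b U.1)ᵀ * firstColumns b U.1 = 1 := by
  ext i j
  have hU := congrFun₂ ((Matrix.mem_orthogonalGroup_iff' (Fin a) ℝ).1 U.2)
    (Fin.castLE h i) (Fin.castLE h j)
  simpa [Matrix.mul_apply, firstColumns_apply h, Matrix.one_apply] using hU

lemma ae_stiefelUniform_transpose_mul_self {a b : ℕ} (h : b ≤ a) :
    ∀ᵐ P ∂(stiefelUniform a b), Pᵀ * P = 1 := by
  have hmeas : MeasurableSet {P : Matrix (Fin a) (Fin b) ℝ | Pᵀ * P = 1} :=
    (isClosed_eq (by fun_prop) continuous_const).measurableSet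
  rw [stiefelUniform, ae_map_iff (measurable_firstColumns a b).aemeasurable hmeas]
  exact .of_forall (transpose_mul_firstColumns h)

lemma integrable_stiefelUniform_mul_transpose {a b : ℕ} (i j : Fin a) :
    Integrable (fun P => (P * Pᵀ) i j) (stiefelUniform a b) := by
  have hc : Continuous fun P : Matrix (Fin a) (Fin b) ℝ => (P * Pᵀ) i j := by fun_prop
  rw [stiefelUniform, integrable_map_measure hc.aestronglyMeasurable
    (measurable_firstColumns a b).aemeasurable]
  refine integrable_orthogonalHaar_of_continuous ?_
  unfold firstColumns
  fun_prop

lemma integral_stiefelUniform_mul_transpose {a b : ℕ} (h : b ≤ a) (i j : Fin a) :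
    ∫ P, (P * Pᵀ) i j ∂(stiefelUniform a b)
      = ((b / a : ℝ) • (1 : Matrix (Fin a) (Fin a) ℝ)) i j := by
  have hc : Continuous fun P : Matrix (Fin a) (Fin b) ℝ => (P * Pᵀ) i j := by fun_prop
  rw [stiefelUniform, integral_map (measurable_firstColumns a b).aemeasurable
    hc.aestronglyMeasurable]
  simp only [Matrix.mul_apply, Matrix.transpose_apply, firstColumns_apply h]
  rw [integral_finsetSum _ fun k _ => integrable_entry_mul_entry ..]
  obtain rfl | hij := eq_or_ne i j
  · simp [← sq, integral_entry_sq, div_eq_mul_inv]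
  · simp [integral_entry_mul_entry_of_row_ne hij, hij]

/-! ### The Frobenius norm of random projections -/

lemma frobSq_eq_trace_mul_transpose {a b : ℕ} (A : Matrix (Fin a) (Fin b) ℝ) :
    frobSq A = (A * Aᵀ).trace := by
  simp only [frobSq, Matrix.trace, Matrix.diag, Matrix.mul_apply, Matrix.transpose_apply, sq]

lemma frobSq_eq_trace_transpose_mul {a b : ℕ} (A : Matrix (Fin a) (Fin b) ℝ) :
    frobSq A = (Aᵀ * A).trace := by
  rw [frobSq_eq_trace_mul_transpose, Matrix.trace_mul_comm]

lemma frobSq_transpose {a b : ℕ} (A : Matrix (Fin a) (Fin b) ℝ) : frobSq Aᵀ = frobSq A := by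
  rw [frobSq_eq_trace_transpose_mul, Matrix.transpose_transpose, frobSq_eq_trace_mul_transpose]

lemma frobSq_nonneg {a b : ℕ} (A : Matrix (Fin a) (Fin b) ℝ) : 0 ≤ frobSq A :=
  Finset.sum_nonneg fun _ _ => Finset.sum_nonneg fun _ _ => sq_nonneg _

lemma continuous_frobSq {a b : ℕ} : Continuous (frobSq : Matrix (Fin a) (Fin b) ℝ → ℝ) := by
  unfold frobSq
  fun_prop

lemma frobSq_mul_transpose_mul {a b c : ℕ} {P : Matrix (Fin a) (Fin b) ℝ} (hP : Pᵀ * P = 1)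
    (A : Matrix (Fin a) (Fin c) ℝ) : frobSq (P * Pᵀ * A) = (P * Pᵀ * (A * Aᵀ)).trace := by
  have h : (P * Pᵀ * A)ᵀ * (P * Pᵀ * A) = Aᵀ * (P * Pᵀ * A) := by
    simp only [Matrix.transpose_mul, Matrix.transpose_transpose, Matrix.mul_assoc]
    rw [← Matrix.mul_assoc Pᵀ P, hP, Matrix.one_mul]
  rw [frobSq_eq_trace_transpose_mul, h, Matrix.trace_mul_comm, Matrix.mul_assoc]

lemma integral_frobSq_stiefelUniform {a b c : ℕ} (h : b ≤ a) (A : Matrix (Fin a) (Fin c) ℝ) :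
    ∫ P, frobSq (P * Pᵀ * A) ∂(stiefelUniform a b) = b / a * frobSq A := by
  rw [integral_congr_ae ((ae_stiefelUniform_transpose_mul_self h).mono fun P hP =>
    frobSq_mul_transpose_mul hP A)]
  simp only [Matrix.trace, Matrix.diag, Matrix.mul_apply (M := _ * _ᵀ) (N := A * Aᵀ)]
  have hint : ∀ i j, Integrable (fun P : Matrix (Fin a) (Fin b) ℝ =>
      (P * Pᵀ) i j * (A * Aᵀ) j i) (stiefelUniform a b) :=
    fun i j => (integrable_stiefelUniform_mul_transpose i j).mul_const _
  rw [integral_finsetSum _ fun i _ => integrable_finsetSum _ fun j _ => hint i j]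
  simp_rw [integral_finsetSum _ fun j _ => hint _ j, integral_mul_const,
    integral_stiefelUniform_mul_transpose h, ← Matrix.mul_apply]
  rw [Matrix.smul_mul, Matrix.one_mul, frobSq_eq_trace_mul_transpose, ← smul_eq_mul,
    ← Matrix.trace_smul, Matrix.trace]
  rfl

/-! ### Parameter vectors and their blocks -/

section Blocks

variable {N : ℕ} {m n r : Fin N → ℕ}

@[simp] lemma block_assemble (X : ∀ ℓ, Matrix (Fin (m ℓ)) (Fin (n ℓ)) ℝ) (ℓ : Fin N) :
    block (assemble X) ℓ = X ℓ := rfl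

@[simp] lemma block_add (x y : Params m n) (ℓ : Fin N) :
    block (x + y) ℓ = block x ℓ + block y ℓ := rfl

@[simp] lemma block_sub (x y : Params m n) (ℓ : Fin N) :
    block (x - y) ℓ = block x ℓ - block y ℓ := rfl

@[simp] lemma block_smul (c : ℝ) (x : Params m n) (ℓ : Fin N) :
    block (c • x) ℓ = c • block x ℓ := rfl

lemma block_ext {x y : Params m n} (h : ∀ ℓ, block x ℓ = block y ℓ) : x = y := by
  ext ⟨ℓ, i, j⟩
  exact congrFun₂ (h ℓ) i j

lemma continuous_block (ℓ : Fin N) : Continuous fun x : Params m n => block x ℓ :=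
  continuous_matrix fun _ _ => PiLp.continuous_apply 2 _ _

lemma inner_eq_sum_trace (x y : Params m n) :
    inner ℝ x y = ∑ ℓ, ((block x ℓ)ᵀ * block y ℓ).trace := by
  rw [PiLp.inner_apply, Fintype.sum_sigma]
  refine Finset.sum_congr rfl fun ℓ _ => ?_
  rw [Fintype.sum_prod_type, Finset.sum_comm]
  simp [Matrix.trace, Matrix.mul_apply, block, mul_comm]

lemma norm_sq_eq_sum_frobSq (x : Params m n) : ‖x‖ ^ 2 = ∑ ℓ, frobSq (block x ℓ) := by
  simp only [← real_inner_self_eq_norm_sq, inner_eq_sum_trace, frobSq_eq_trace_transpose_mul]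

/-! ### Blockwise projections and the lifted momentum -/

/-- The blockwise projection onto the current subspaces: it acts on the `ℓ`-th block as
`X ↦ P_ℓ P_ℓᵀ X` if `m_ℓ ≤ n_ℓ` and as `X ↦ X Q_ℓ Q_ℓᵀ` otherwise. -/
noncomputable def blockProj (P : ∀ ℓ, Matrix (Fin (m ℓ)) (Fin (r ℓ)) ℝ)
    (Q : ∀ ℓ, Matrix (Fin (n ℓ)) (Fin (r ℓ)) ℝ) : Params m n →ₗ[ℝ] Params m n where
  toFun x := assemble fun ℓ =>
    if m ℓ ≤ n ℓ then P ℓ * (P ℓ)ᵀ * block x ℓ else block x ℓ * (Q ℓ * (Q ℓ)ᵀ)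
  map_add' x y := block_ext fun ℓ => by
    by_cases h : m ℓ ≤ n ℓ <;> simp [h, Matrix.mul_add, Matrix.add_mul]
  map_smul' c x := block_ext fun ℓ => by
    by_cases h : m ℓ ≤ n ℓ <;> simp [h]

/-- The momentum lifted from the low-dimensional subspaces to the parameter space, where it no
longer depends on a choice of coordinates in the subspaces. -/
noncomputable def fullMomentum (P : ∀ ℓ, Matrix (Fin (m ℓ)) (Fin (r ℓ)) ℝ)
    (Q : ∀ ℓ, Matrix (Fin (n ℓ)) (Fin (r ℓ)) ℝ) (s : State m n r) : Params m n :=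
  assemble fun ℓ => if m ℓ ≤ n ℓ then P ℓ * s.left ℓ else s.right ℓ * (Q ℓ)ᵀ

/-- All matrices of the two families have orthonormal columns. -/
def OrthonormalColumns (P : ∀ ℓ, Matrix (Fin (m ℓ)) (Fin (r ℓ)) ℝ)
    (Q : ∀ ℓ, Matrix (Fin (n ℓ)) (Fin (r ℓ)) ℝ) : Prop :=
  ∀ ℓ, (P ℓ)ᵀ * P ℓ = 1 ∧ (Q ℓ)ᵀ * Q ℓ = 1

variable {P P' : ∀ ℓ, Matrix (Fin (m ℓ)) (Fin (r ℓ)) ℝ}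
  {Q Q' : ∀ ℓ, Matrix (Fin (n ℓ)) (Fin (r ℓ)) ℝ}

lemma block_blockProj (x : Params m n) (ℓ : Fin N) :
    block (blockProj P Q x) ℓ
      = if m ℓ ≤ n ℓ then P ℓ * (P ℓ)ᵀ * block x ℓ else block x ℓ * (Q ℓ * (Q ℓ)ᵀ) := rfl

lemma block_fullMomentum (s : State m n r) (ℓ : Fin N) :
    block (fullMomentum P Q s) ℓ
      = if m ℓ ≤ n ℓ then P ℓ * s.left ℓ else s.right ℓ * (Q ℓ)ᵀ := rfl

lemma blockProj_isSymmetric : (blockProj P Q).IsSymmetric := fun x y => by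
  rw [inner_eq_sum_trace, inner_eq_sum_trace]
  refine Finset.sum_congr rfl fun ℓ _ => ?_
  rw [block_blockProj, block_blockProj]
  split_ifs
  · simp only [Matrix.transpose_mul, Matrix.transpose_transpose, Matrix.mul_assoc]
  · rw [Matrix.transpose_mul, Matrix.transpose_mul, Matrix.transpose_transpose,
      Matrix.trace_mul_cycle', Matrix.mul_assoc]

namespace OrthonormalColumns

variable (h : OrthonormalColumns P Q)
include h

lemma transpose_mul_mul_left (ℓ : Fin N) {k : ℕ} (A : Matrix (Fin (r ℓ)) (Fin k) ℝ) :
    (P ℓ)ᵀ * (P ℓ * A) = A := by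
  rw [← Matrix.mul_assoc, (h ℓ).1, Matrix.one_mul]

lemma transpose_mul_mul_right (ℓ : Fin N) {k : ℕ} (A : Matrix (Fin (r ℓ)) (Fin k) ℝ) :
    (Q ℓ)ᵀ * (Q ℓ * A) = A := by
  rw [← Matrix.mul_assoc, (h ℓ).2, Matrix.one_mul]

lemma isSymmetricProjection_blockProj : (blockProj P Q).IsSymmetricProjection where
  isSymmetric := blockProj_isSymmetric
  isIdempotentElem := LinearMap.ext fun x => block_ext fun ℓ => by
    by_cases hℓ : m ℓ ≤ n ℓ <;>
      simp [block_blockProj, hℓ, Matrix.mul_assoc, h.transpose_mul_mul_left,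
        h.transpose_mul_mul_right]

lemma fullMomentum_step_of_not_dvd (β η : ℝ) {τ t : ℕ} (ht : ¬ τ ∣ t) (G : Params m n)
    (s : State m n r) :
    fullMomentum P Q (step β η τ t P P' Q Q' G s)
      = blockProj P Q ((1 - β) • fullMomentum P Q s + β • G) := block_ext fun ℓ => by
  by_cases hℓ : m ℓ ≤ n ℓ <;>
    simp [step, hℓ, ht, block_fullMomentum, block_blockProj, Matrix.mul_add, Matrix.add_mul,
      Matrix.mul_assoc, h.transpose_mul_mul_left, h.transpose_mul_mul_right]

end OrthonormalColumns

lemma fullMomentum_step_of_dvd (β η : ℝ) {τ t : ℕ} (ht : τ ∣ t) (G : Params m n)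
    (s : State m n r) :
    fullMomentum P Q (step β η τ t P P' Q Q' G s)
      = blockProj P Q ((1 - β) • fullMomentum P' Q' s + β • G) := block_ext fun ℓ => by
  by_cases hℓ : m ℓ ≤ n ℓ <;>
    simp [step, hℓ, ht, block_fullMomentum, block_blockProj, Matrix.mul_add, Matrix.add_mul,
      Matrix.mul_assoc]

lemma step_x (β η : ℝ) (τ t : ℕ) (G : Params m n) (s : State m n r) :
    (step β η τ t P P' Q Q' G s).x
      = s.x - η • fullMomentum P Q (step β η τ t P P' Q Q' G s) := block_ext fun ℓ => by
  by_cases hℓ : m ℓ ≤ n ℓ <;> simp [step, hℓ, block_fullMomentum]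

end Blocks

/-! ### Symmetric projections, weighted triangle inequalities and the descent lemma -/

section SymmetricProjection

variable {𝕜 E : Type*} [RCLike 𝕜] [NormedAddCommGroup E] [InnerProductSpace 𝕜 E] {A : E →ₗ[𝕜] E}

lemma apply_apply_of_isSymmetricProjection (h : A.IsSymmetricProjection) (x : E) :
    A (A x) = A x :=
  LinearMap.congr_fun h.isIdempotentElem x

lemma norm_apply_sq_add_norm_sub_apply_sq (h : A.IsSymmetricProjection) (x : E) :
    ‖A x‖ ^ 2 + ‖x - A x‖ ^ 2 = ‖x‖ ^ 2 := by
  have hinner : RCLike.re (inner 𝕜 x (A x)) = ‖A x‖ ^ 2 := by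
    rw [← inner_self_eq_norm_sq (𝕜 := 𝕜), h.isSymmetric,
      apply_apply_of_isSymmetricProjection h]
  rw [norm_sub_sq (𝕜 := 𝕜), hinner]
  ring

lemma norm_apply_le_of_isSymmetricProjection (h : A.IsSymmetricProjection) (x : E) :
    ‖A x‖ ≤ ‖x‖ :=
  le_of_sq_le_sq (by nlinarith [norm_apply_sq_add_norm_sub_apply_sq h x]) (norm_nonneg _)

lemma norm_sub_apply_le_of_isSymmetricProjection (h : A.IsSymmetricProjection) (x : E) :
    ‖x - A x‖ ≤ ‖x‖ :=
  le_of_sq_le_sq (by nlinarith [norm_apply_sq_add_norm_sub_apply_sq h x]) (norm_nonneg _)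

lemma norm_sub_sq_of_apply_eq (h : A.IsSymmetricProjection) {y : E} (hy : A y = y) (x : E) :
    ‖y - x‖ ^ 2 = ‖y - A x‖ ^ 2 + ‖x - A x‖ ^ 2 := by
  have hsplit := norm_apply_sq_add_norm_sub_apply_sq h (y - x)
  rwa [map_sub, hy, sub_sub_sub_cancel_left, norm_sub_rev (A x), eq_comm] at hsplit

end SymmetricProjection

lemma norm_add_sq_le_weighted {E : Type*} [SeminormedAddGroup E] {a : ℝ} (ha : 0 < a) (x y : E) :
    ‖x + y‖ ^ 2 ≤ (1 + a) * ‖x‖ ^ 2 + (1 + 1 / a) * ‖y‖ ^ 2 := by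
  have hsq : (1 + a) * ‖x‖ ^ 2 + (1 + 1 / a) * ‖y‖ ^ 2 - (‖x‖ + ‖y‖) ^ 2
      = (a * ‖x‖ - ‖y‖) ^ 2 / a := by
    field_simp
    ring
  have hnonneg : 0 ≤ (a * ‖x‖ - ‖y‖) ^ 2 / a := by positivity
  calc ‖x + y‖ ^ 2 ≤ (‖x‖ + ‖y‖) ^ 2 := by gcongr; exact norm_add_le x y
    _ ≤ _ := by linarith

lemma norm_smul_add_sq_le {E : Type*} [SeminormedAddCommGroup E] [NormedSpace ℝ E] {β : ℝ}
    (hβ : 0 < β) (hβ1 : β ≤ 1) (x y : E) :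
    ‖(1 - β) • (x + y)‖ ^ 2 ≤ (1 - β) * ‖x‖ ^ 2 + 1 / β * ‖y‖ ^ 2 := by
  obtain rfl | hβ1 := hβ1.eq_or_lt
  · simp
  have hβ' : 0 < 1 - β := sub_pos.2 hβ1
  calc ‖(1 - β) • (x + y)‖ ^ 2 = (1 - β) ^ 2 * ‖x + y‖ ^ 2 := by
        rw [norm_smul, mul_pow, Real.norm_eq_abs, sq_abs]
    _ ≤ (1 - β) ^ 2 * ((1 + β / (1 - β)) * ‖x‖ ^ 2 + (1 + 1 / (β / (1 - β))) * ‖y‖ ^ 2) := by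
        gcongr
        exact norm_add_sq_le_weighted (div_pos hβ hβ') x y
    _ = (1 - β) * ‖x‖ ^ 2 + (1 - β) ^ 2 / β * ‖y‖ ^ 2 := by
        field_simp
        ring
    _ ≤ _ := by
        gcongr
        nlinarith

section Descent

variable {E : Type*} [NormedAddCommGroup E] [InnerProductSpace ℝ E] [CompleteSpace E] {f : E → ℝ}

lemma hasDerivAt_comp_add_smul (hf : Differentiable ℝ f) (x d : E) (t : ℝ) :
    HasDerivAt (fun t : ℝ => f (x + t • d)) (inner ℝ (gradient f (x + t • d)) d) t := by
  have hline : HasDerivAt (fun t : ℝ => x + t • d) d t := by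
    simpa using ((hasDerivAt_id t).smul_const d).const_add x
  simpa [InnerProductSpace.toDual_apply_apply, Function.comp_def] using
    (hf (x + t • d)).hasGradientAt.hasFDerivAt.comp_hasDerivAt t hline

/-- The remainder of the first-order expansion minus `L t² ‖d‖² / 2` is antitone along the ray. -/
lemma le_add_inner_gradient_add_of_lipschitz {L : ℝ} (hf : Differentiable ℝ f)
    (hL : ∀ x y, ‖gradient f x - gradient f y‖ ≤ L * ‖x - y‖) (x d : E) :
    f (x + d) ≤ f x + inner ℝ (gradient f x) d + L / 2 * ‖d‖ ^ 2 := by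
  let R : ℝ → ℝ := fun t => f (x + t • d) - t * inner ℝ (gradient f x) d - L / 2 * ‖d‖ ^ 2 * t ^ 2
  have hR : ∀ t, HasDerivAt R
      (inner ℝ (gradient f (x + t • d) - gradient f x) d - L * t * ‖d‖ ^ 2) t := fun t => by
    have hlin := (hasDerivAt_id t).mul_const (inner ℝ (gradient f x) d)
    have hquad := (hasDerivAt_pow 2 t).const_mul (L / 2 * ‖d‖ ^ 2)
    refine (((hasDerivAt_comp_add_smul hf x d t).sub hlin).sub hquad).congr_deriv ?_
    rw [inner_sub_left]
    ring
  have hanti : AntitoneOn R (Set.Icc 0 1) := by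
    refine antitoneOn_of_deriv_nonpos (convex_Icc 0 1)
      (fun t _ => (hR t).continuousAt.continuousWithinAt)
      (fun t _ => (hR t).differentiableAt.differentiableWithinAt) fun t ht => ?_
    rw [interior_Icc] at ht
    rw [(hR t).deriv, sub_nonpos]
    calc inner ℝ (gradient f (x + t • d) - gradient f x) d
        ≤ ‖gradient f (x + t • d) - gradient f x‖ * ‖d‖ := real_inner_le_norm _ _
      _ ≤ L * ‖x + t • d - x‖ * ‖d‖ := by gcongr; exact hL _ _
      _ = L * t * ‖d‖ ^ 2 := by
        rw [add_sub_cancel_left, norm_smul, Real.norm_of_nonneg ht.1.le]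
        ring
  have := hanti (Set.left_mem_Icc.2 zero_le_one) (Set.right_mem_Icc.2 zero_le_one) zero_le_one
  simp only [R, one_smul, zero_smul, add_zero] at this
  linarith

lemma continuous_gradient_of_lipschitz {L : ℝ}
    (hL : ∀ x y, ‖gradient f x - gradient f y‖ ≤ L * ‖x - y‖) : Continuous (gradient f) :=
  (LipschitzWith.of_dist_le_mul (K := L.toNNReal) fun x y => by
    rw [dist_eq_norm, dist_eq_norm]
    exact (hL x y).trans (by gcongr; exact Real.le_coe_toNNReal L)).continuous

end Descent

/-! ### Hyperparameters -/

/-- The smoothness constant `L`, the rank ratio `δ` and the hyperparameters `β`, `η`, `τ` satisfy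
the conditions under which the averaged gradient bound holds. -/
structure Admissible (L δ β η : ℝ) (τ : ℕ) : Prop where
  L_pos : 0 < L
  δ_pos : 0 < δ
  δ_le_one : δ ≤ 1
  β_pos : 0 < β
  β_le_one : β ≤ 1
  le_period : 64 / (3 * β * δ) ≤ (τ : ℝ)
  η_pos : 0 < η
  η_le : η ≤ min (min (1 / (4 * L)) √(3 * δ * β ^ 2 / (80 * L ^ 2)))
    (min √(3 * δ / (80 * (τ : ℝ) ^ 2 * L ^ 2)) √(3 * β / (16 * (τ : ℝ) * L ^ 2)))

namespace Admissible

variable {L δ β η : ℝ} {τ : ℕ} (h : Admissible L δ β η τ)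
include h

lemma sixty_four_le : 64 ≤ 3 * β * δ * τ := by
  have hβ := h.β_pos
  have hδ := h.δ_pos
  rw [← div_le_iff₀' (by positivity)]
  exact h.le_period

lemma three_le_period : 3 ≤ (τ : ℝ) := by
  have hβδ : β * δ ≤ 1 := mul_le_one₀ h.β_le_one h.δ_pos.le h.δ_le_one
  nlinarith [h.sixty_four_le, Nat.cast_nonneg (α := ℝ) τ]

lemma period_pos : 0 < τ := by
  have := h.three_le_period
  rw [← Nat.cast_pos (α := ℝ)]
  linarith

lemma smoothness_mul_η_le : L * η ≤ 1 / 4 := by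
  have hL := h.L_pos
  have hη : η ≤ 1 / (4 * L) := h.η_le.trans ((min_le_left _ _).trans (min_le_left _ _))
  calc L * η ≤ L * (1 / (4 * L)) := by gcongr
    _ = 1 / 4 := by field_simp

lemma smoothness_div_momentum_sq_mul_le : L ^ 2 / β ^ 2 * η ^ 2 ≤ 3 / 80 := by
  have hL := h.L_pos
  have hβ := h.β_pos
  have hη : η ^ 2 ≤ 3 * δ * β ^ 2 / (80 * L ^ 2) := (Real.le_sqrt' h.η_pos).1
    (h.η_le.trans ((min_le_left _ _).trans (min_le_right _ _)))
  calc L ^ 2 / β ^ 2 * η ^ 2 ≤ L ^ 2 / β ^ 2 * (3 * δ * β ^ 2 / (80 * L ^ 2)) := by gcongr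
    _ = 3 * δ / 80 := by field_simp
    _ ≤ 3 / 80 := by linarith [h.δ_le_one]

lemma smoothness_mul_period_sq_div_mul_le : L ^ 2 * τ ^ 2 / δ * η ^ 2 ≤ 3 / 80 := by
  have hL := h.L_pos
  have hδ := h.δ_pos
  have hτ : (0 : ℝ) < τ := by exact_mod_cast h.period_pos
  have hη : η ^ 2 ≤ 3 * δ / (80 * (τ : ℝ) ^ 2 * L ^ 2) := (Real.le_sqrt' h.η_pos).1
    (h.η_le.trans ((min_le_right _ _).trans (min_le_left _ _)))
  calc L ^ 2 * τ ^ 2 / δ * η ^ 2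
      ≤ L ^ 2 * τ ^ 2 / δ * (3 * δ / (80 * (τ : ℝ) ^ 2 * L ^ 2)) := by gcongr
    _ = 3 / 80 := by field_simp

lemma smoothness_mul_period_div_mul_le : L ^ 2 * τ / β * η ^ 2 ≤ 3 / 16 := by
  have hL := h.L_pos
  have hβ := h.β_pos
  have hτ : (0 : ℝ) < τ := by exact_mod_cast h.period_pos
  have hη : η ^ 2 ≤ 3 * β / (16 * (τ : ℝ) * L ^ 2) := (Real.le_sqrt' h.η_pos).1
    (h.η_le.trans ((min_le_right _ _).trans (min_le_right _ _)))
  calc L ^ 2 * τ / β * η ^ 2 ≤ L ^ 2 * τ / β * (3 * β / (16 * (τ : ℝ) * L ^ 2)) := by gcongr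
    _ = 3 / 16 := by field_simp

end Admissible

/-! ### Summing the recursions over periods -/

lemma sum_range_mul_eq {M : Type*} [AddCommMonoid M] (h : ℕ → M) (τ K : ℕ) :
    ∑ t ∈ Finset.range (K * τ), h t
      = ∑ k ∈ Finset.range K, ∑ j ∈ Finset.range τ, h (k * τ + j) := by
  induction K with
  | zero => simp
  | succ K ih => rw [add_mul, one_mul, Finset.sum_range_add, ih, Finset.sum_range_succ]

lemma dvd_mul_add_add_one_iff {τ j : ℕ} (hj : j < τ) (k : ℕ) :
    τ ∣ k * τ + j + 1 ↔ j = τ - 1 := by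
  rw [add_assoc, Nat.dvd_add_right (Dvd.intro_left k rfl)]
  refine ⟨fun hd => ?_, ?_⟩
  · have := Nat.le_of_dvd j.succ_pos hd
    omega
  · rintro rfl
    rw [Nat.sub_add_cancel (by omega)]

lemma sum_ite_dvd_succ {M : Type*} [AddCommMonoid M] (h : ℕ → M) {τ : ℕ} (hτ : 0 < τ) (K : ℕ) :
    ∑ t ∈ Finset.range (K * τ), (if τ ∣ t + 1 then h t else 0)
      = ∑ k ∈ Finset.range K, h (k * τ + (τ - 1)) := by
  rw [sum_range_mul_eq]
  refine Finset.sum_congr rfl fun k _ => ?_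
  have hlast : ∀ j ∈ Finset.range τ, (if τ ∣ k * τ + j + 1 then h (k * τ + j) else 0)
      = if j = τ - 1 then h (k * τ + j) else 0 := fun j hj => by
    simp only [dvd_mul_add_add_one_iff (Finset.mem_range.1 hj)]
  rw [Finset.sum_congr rfl hlast, Finset.sum_ite_eq',
    if_pos (Finset.mem_range.2 (Nat.sub_lt hτ one_pos))]

lemma leaky_sum_le {β c : ℝ} {u w : ℕ → ℝ}
    (h : ∀ t, u (t + 1) ≤ (1 - β) * u t + w t + c) (n : ℕ) :
    β * ∑ t ∈ Finset.range n, u t + u n ≤ u 0 + ∑ t ∈ Finset.range n, w t + n * c := by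
  induction n with
  | zero => simp
  | succ n ih =>
    rw [Finset.sum_range_succ, Finset.sum_range_succ]
    push_cast
    linarith [h n]

lemma sum_range_cast_le (τ : ℕ) : ∑ j ∈ Finset.range τ, (j : ℝ) ≤ (τ : ℝ) ^ 2 / 2 := by
  induction τ with
  | zero => simp
  | succ k ih =>
    rw [Finset.sum_range_succ]
    push_cast
    linarith

lemma sum_mul_partial_sum_le {d : ℕ → ℝ} (hd : ∀ t, 0 ≤ d t) (τ : ℕ) :
    ∑ j ∈ Finset.range τ, (j : ℝ) * ∑ i ∈ Finset.range j, d i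
      ≤ (τ : ℝ) ^ 2 / 2 * ∑ i ∈ Finset.range τ, d i := by
  calc ∑ j ∈ Finset.range τ, (j : ℝ) * ∑ i ∈ Finset.range j, d i
      ≤ ∑ j ∈ Finset.range τ, (j : ℝ) * ∑ i ∈ Finset.range τ, d i := by
        refine Finset.sum_le_sum fun j hj => ?_
        have hjτ := (Finset.mem_range.1 hj).le
        gcongr
        exact fun i _ _ => hd i
    _ = (∑ j ∈ Finset.range τ, (j : ℝ)) * ∑ i ∈ Finset.range τ, d i := (Finset.sum_mul ..).symm
    _ ≤ _ := mul_le_mul_of_nonneg_right (sum_range_cast_le τ) (Finset.sum_nonneg fun i _ => hd i)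

/-- The recursions behind the convergence bound: `g`, `d`, `u` and `v` stand for the expected
squared norms of the gradient, of the displacement, of the error of the momentum within the
current subspace and of the part of the gradient outside it, and `φ` for the expected loss. -/
structure ScalarRecursion (L δ β η s : ℝ) (τ : ℕ) (g d u v φ : ℕ → ℝ) : Prop where
  g_nonneg : ∀ t, 0 ≤ g t
  d_nonneg : ∀ t, 0 ≤ d t
  u_nonneg : ∀ t, 0 ≤ u t
  v_le : ∀ t, v t ≤ g t
  descent : ∀ t, φ (t + 1) ≤ φ t - η / 2 * g t - 3 / (8 * η) * d t + η / 2 * (u t + v t)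
  u_zero : u 0 ≤ g 0 + β ^ 2 * s ^ 2
  u_succ : ∀ t, u (t + 1) ≤ (1 - β) * (u t + if τ ∣ t + 1 then v t else 0)
    + L ^ 2 / β * d t + β ^ 2 * s ^ 2
  v_period : ∀ k j, j < τ → v (k * τ + j) ≤ (1 - δ / 2) * g (k * τ + j)
    + 8 / δ * L ^ 2 * (j * ∑ i ∈ Finset.range j, d (k * τ + i))
  g_period : ∀ k i j, i < τ → j < τ → g (k * τ + i) ≤ 4 * g (k * τ + j)
    + 4 / 3 * L ^ 2 * τ * ∑ i ∈ Finset.range τ, d (k * τ + i)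

namespace ScalarRecursion

variable {L δ β η s : ℝ} {τ : ℕ} {g d u v φ : ℕ → ℝ}
  (h : ScalarRecursion L δ β η s τ g d u v φ)
include h

lemma sum_u_le (hβ : 0 ≤ β) (hβ1 : β ≤ 1) (hτ : 0 < τ) (K : ℕ) :
    β * ∑ t ∈ Finset.range (K * τ), u t
      ≤ g 0 + ∑ k ∈ Finset.range K, g (k * τ + (τ - 1))
        + L ^ 2 / β * ∑ t ∈ Finset.range (K * τ), d t + (K * τ + 1) * (β ^ 2 * s ^ 2) := by
  have hrefresh : ∀ t, (1 - β) * (if τ ∣ t + 1 then v t else 0) ≤ if τ ∣ t + 1 then g t else 0 := by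
    intro t
    split_ifs
    · nlinarith [h.v_le t, h.g_nonneg t]
    · simp
  have hleaky := leaky_sum_le (β := β) (c := β ^ 2 * s ^ 2) (u := u)
    (w := fun t => (if τ ∣ t + 1 then g t else 0) + L ^ 2 / β * d t)
    (fun t => by linarith [h.u_succ t, hrefresh t]) (K * τ)
  rw [Finset.sum_add_distrib, sum_ite_dvd_succ _ hτ, ← Finset.mul_sum] at hleaky
  push_cast at hleaky
  linarith [h.u_nonneg (K * τ), h.u_zero]

lemma sum_v_le (hδ : 0 ≤ δ) (K : ℕ) :
    ∑ t ∈ Finset.range (K * τ), v t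
      ≤ (1 - δ / 2) * ∑ t ∈ Finset.range (K * τ), g t
        + 4 * (L ^ 2 * τ ^ 2 / δ) * ∑ t ∈ Finset.range (K * τ), d t := by
  simp only [sum_range_mul_eq, Finset.mul_sum (Finset.range K), ← Finset.sum_add_distrib]
  refine Finset.sum_le_sum fun k _ => ?_
  calc ∑ j ∈ Finset.range τ, v (k * τ + j)
      ≤ ∑ j ∈ Finset.range τ, ((1 - δ / 2) * g (k * τ + j)
        + 8 / δ * L ^ 2 * (j * ∑ i ∈ Finset.range j, d (k * τ + i))) :=
        Finset.sum_le_sum fun j hj => h.v_period k j (Finset.mem_range.1 hj)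
    _ = (1 - δ / 2) * ∑ j ∈ Finset.range τ, g (k * τ + j) + 8 / δ * L ^ 2 *
        ∑ j ∈ Finset.range τ, (j : ℝ) * ∑ i ∈ Finset.range j, d (k * τ + i) := by
        rw [Finset.sum_add_distrib, Finset.mul_sum, Finset.mul_sum]
    _ ≤ (1 - δ / 2) * ∑ j ∈ Finset.range τ, g (k * τ + j) + 8 / δ * L ^ 2 *
        ((τ : ℝ) ^ 2 / 2 * ∑ i ∈ Finset.range τ, d (k * τ + i)) := by
        gcongr
        exact sum_mul_partial_sum_le (fun t => h.d_nonneg (k * τ + t)) τ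
    _ = _ := by ring

lemma period_mul_g_le (k i : ℕ) (hi : i < τ) :
    τ * g (k * τ + i) ≤ 4 * ∑ j ∈ Finset.range τ, g (k * τ + j)
      + 4 / 3 * L ^ 2 * τ ^ 2 * ∑ i ∈ Finset.range τ, d (k * τ + i) := by
  have hsum := Finset.sum_le_sum fun j (hj : j ∈ Finset.range τ) =>
    h.g_period k i j hi (Finset.mem_range.1 hj)
  rw [Finset.sum_add_distrib, ← Finset.mul_sum] at hsum
  simp only [Finset.sum_const, Finset.card_range, nsmul_eq_mul] at hsum
  linarith

/-- The gradients within one period are comparable, so those at the refreshes amount to a fraction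
`1 / τ` of the sum over all steps. -/
lemma period_mul_sum_refreshed_le (hτ : 0 < τ) {K : ℕ} (hK : 0 < K) :
    τ * (g 0 + ∑ k ∈ Finset.range K, g (k * τ + (τ - 1)))
      ≤ 8 * ∑ t ∈ Finset.range (K * τ), g t
        + 8 / 3 * L ^ 2 * τ ^ 2 * ∑ t ∈ Finset.range (K * τ), d t := by
  have hlast : τ * ∑ k ∈ Finset.range K, g (k * τ + (τ - 1))
      ≤ 4 * ∑ t ∈ Finset.range (K * τ), g t
        + 4 / 3 * L ^ 2 * τ ^ 2 * ∑ t ∈ Finset.range (K * τ), d t := by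
    simp only [sum_range_mul_eq, Finset.mul_sum (Finset.range K), ← Finset.sum_add_distrib]
    exact Finset.sum_le_sum fun k _ => h.period_mul_g_le k (τ - 1) (by omega)
  have hfirst : τ * g 0 ≤ 4 * ∑ t ∈ Finset.range (K * τ), g t
      + 4 / 3 * L ^ 2 * τ ^ 2 * ∑ t ∈ Finset.range (K * τ), d t := by
    have hsub : Finset.range τ ⊆ Finset.range (K * τ) :=
      Finset.range_subset_range.2 (Nat.le_mul_of_pos_left τ hK)
    have h0 := h.period_mul_g_le 0 0 hτ
    simp only [zero_mul, zero_add] at h0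
    refine h0.trans ?_
    gcongr
    · exact fun i _ _ => h.g_nonneg i
    · exact fun i _ _ => h.d_nonneg i
  linarith

lemma sum_u_add_sum_v_le (ha : Admissible L δ β η τ) {K : ℕ} (hK : 1 ≤ K) :
    ∑ t ∈ Finset.range (K * τ), u t + ∑ t ∈ Finset.range (K * τ), v t
      ≤ (1 - δ / 8) * ∑ t ∈ Finset.range (K * τ), g t
        + 3 / (4 * η ^ 2) * ∑ t ∈ Finset.range (K * τ), d t
        + 4 / 3 * (K * τ) * (β * s ^ 2) := by
  have hβ := ha.β_pos
  have hη := ha.η_pos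
  have hτ : (0 : ℝ) < τ := by exact_mod_cast ha.period_pos
  have hu := h.sum_u_le hβ.le ha.β_le_one ha.period_pos K
  have hv := h.sum_v_le ha.δ_pos.le K
  have hw := h.period_mul_sum_refreshed_le ha.period_pos hK
  set A := ∑ t ∈ Finset.range (K * τ), g t
  set B := ∑ t ∈ Finset.range (K * τ), d t
  set U := ∑ t ∈ Finset.range (K * τ), u t
  set W := g 0 + ∑ k ∈ Finset.range K, g (k * τ + (τ - 1))
  have hA : 0 ≤ A := Finset.sum_nonneg fun t _ => h.g_nonneg t
  have hB : 0 ≤ B := Finset.sum_nonneg fun t _ => h.d_nonneg t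
  have hU : U ≤ 8 / (β * τ) * A + (8 / 3 * (L ^ 2 * τ / β) + L ^ 2 / β ^ 2) * B
      + (K * τ + 1) * (β * s ^ 2) := by
    calc U = β * U / β := by field_simp
      _ ≤ (τ * W / τ + L ^ 2 / β * B + (K * τ + 1) * (β ^ 2 * s ^ 2)) / β := by
        rw [mul_div_cancel_left₀ _ hτ.ne']
        gcongr
      _ ≤ ((8 * A + 8 / 3 * L ^ 2 * τ ^ 2 * B) / τ + L ^ 2 / β * B
          + (K * τ + 1) * (β ^ 2 * s ^ 2)) / β := by gcongr
      _ = _ := by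
        field_simp
        ring
  have hcoeffA : 8 / (β * τ) ≤ 3 / 8 * δ := by
    rw [div_le_iff₀ (by positivity)]
    linarith [ha.sixty_four_le]
  have hcoeffB : 8 / 3 * (L ^ 2 * τ / β) + L ^ 2 / β ^ 2 + 4 * (L ^ 2 * τ ^ 2 / δ)
      ≤ 3 / (4 * η ^ 2) := by
    rw [le_div_iff₀ (by positivity)]
    linarith [ha.smoothness_div_momentum_sq_mul_le, ha.smoothness_mul_period_sq_div_mul_le,
      ha.smoothness_mul_period_div_mul_le]
  have hcoeffs : (K * τ + 1 : ℝ) ≤ 4 / 3 * (K * τ) := by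
    have hK' : (1 : ℝ) ≤ K := by exact_mod_cast hK
    nlinarith [ha.three_le_period]
  linarith [mul_le_mul_of_nonneg_right hcoeffA hA, mul_le_mul_of_nonneg_right hcoeffB hB,
    mul_le_mul_of_nonneg_right hcoeffs (by positivity : 0 ≤ β * s ^ 2)]

lemma sum_descent (n : ℕ) :
    φ n ≤ φ 0 - η / 2 * ∑ t ∈ Finset.range n, g t - 3 / (8 * η) * ∑ t ∈ Finset.range n, d t
      + η / 2 * (∑ t ∈ Finset.range n, u t + ∑ t ∈ Finset.range n, v t) := by
  induction n with
  | zero => simp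
  | succ n ih =>
    simp only [Finset.sum_range_succ]
    linarith [h.descent n]

theorem average_le (ha : Admissible L δ β η τ) {K : ℕ} (hK : 1 ≤ K) :
    1 / ((K : ℝ) * τ) * ∑ t ∈ Finset.range (K * τ), g t
      ≤ 16 * (φ 0 - φ (K * τ)) / (δ * η * K * τ) + 32 * β * s ^ 2 / (3 * δ) := by
  have hδ := ha.δ_pos
  have hη := ha.η_pos
  have hτ : (0 : ℝ) < τ := by exact_mod_cast ha.period_pos
  have hdescent := h.sum_descent (K * τ)
  have herror := mul_le_mul_of_nonneg_left (h.sum_u_add_sum_v_le ha hK) (half_pos hη).le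
  set A := ∑ t ∈ Finset.range (K * τ), g t
  set B := ∑ t ∈ Finset.range (K * τ), d t
  have hB : η / 2 * (3 / (4 * η ^ 2) * B) = 3 / (8 * η) * B := by
    field_simp
    ring
  calc 1 / ((K : ℝ) * τ) * A = η * δ / 16 * A * (16 / (δ * η * K * τ)) := by
        field_simp
    _ ≤ (φ 0 - φ (K * τ) + η / 2 * (4 / 3 * (K * τ) * (β * s ^ 2)))
          * (16 / (δ * η * K * τ)) := by
        gcongr
        linarith
    _ = _ := by
        field_simp
        ring

end ScalarRecursion

/-! ### Projected momentum descent in a Hilbert space -/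

section General

variable {Ω E : Type*} [MeasurableSpace Ω] {μ : Measure Ω}

lemma integrable_norm_sq_of_memLp_two [NormedAddCommGroup E] {Z : Ω → E} (hZ : MemLp Z 2 μ) :
    Integrable (fun ω => ‖Z ω‖ ^ 2) μ :=
  (memLp_two_iff_integrable_sq_norm hZ.1).1 hZ

lemma integrable_inner_of_memLp_two [NormedAddCommGroup E] [InnerProductSpace ℝ E] {Y Z : Ω → E}
    (hY : MemLp Y 2 μ) (hZ : MemLp Z 2 μ) : Integrable (fun ω => inner ℝ (Y ω) (Z ω)) μ :=
  (hY.norm.integrable_mul hZ.norm).mono' (hY.1.inner hZ.1)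
    (Filter.Eventually.of_forall fun _ => norm_inner_le_norm _ _)

lemma integral_le_linear_combination {X Y Z : Ω → ℝ} (hX : Integrable X μ)
    (hY : Integrable Y μ) (hZ : Integrable Z μ) (a b : ℝ)
    (h : ∀ᵐ ω ∂μ, X ω ≤ a * Y ω + b * Z ω) :
    ∫ ω, X ω ∂μ ≤ a * ∫ ω, Y ω ∂μ + b * ∫ ω, Z ω ∂μ := by
  rw [← integral_const_mul, ← integral_const_mul,
    ← integral_add (hY.const_mul _) (hZ.const_mul _)]
  exact integral_mono_ae hX ((hY.const_mul _).add (hZ.const_mul _)) h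

lemma norm_sub_sq_le_mul_sum [SeminormedAddCommGroup E] (y : ℕ → E) (a j : ℕ) :
    ‖y (a + j) - y a‖ ^ 2 ≤ j * ∑ i ∈ Finset.range j, ‖y (a + i + 1) - y (a + i)‖ ^ 2 := by
  calc ‖y (a + j) - y a‖ ^ 2
      = ‖∑ i ∈ Finset.range j, (y (a + i + 1) - y (a + i))‖ ^ 2 := by
        congr 2
        exact (Finset.sum_range_sub (fun i => y (a + i)) j).symm
    _ ≤ (∑ i ∈ Finset.range j, ‖y (a + i + 1) - y (a + i)‖) ^ 2 := by
        gcongr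
        exact norm_sum_le _ _
    _ ≤ _ := by simpa using sq_sum_le_card_mul_sum_sq (s := Finset.range j)
                  (f := fun i => ‖y (a + i + 1) - y (a + i)‖)

variable [NormedAddCommGroup E] [InnerProductSpace ℝ E]

lemma norm_apply_momentum_sub_apply_sq_le {A : E →ₗ[ℝ] E} (hA : A.IsSymmetricProjection) (β : ℝ)
    (m g ν : E) :
    ‖A ((1 - β) • m + β • (g + ν)) - A g‖ ^ 2
      ≤ ‖(1 - β) • A (m - g)‖ ^ 2 + 2 * (1 - β) * β * inner ℝ (A (m - g)) ν
        + β ^ 2 * ‖ν‖ ^ 2 := by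
  have hsplit : A ((1 - β) • m + β • (g + ν)) - A g = (1 - β) • A (m - g) + β • A ν := by
    rw [← map_sub, ← map_smul, ← map_smul, ← map_add]
    congr 1
    module
  have hν : β ^ 2 * ‖A ν‖ ^ 2 ≤ β ^ 2 * ‖ν‖ ^ 2 := by
    gcongr
    exact norm_apply_le_of_isSymmetricProjection hA ν
  rw [hsplit, norm_add_sq_real, real_inner_smul_left, real_inner_smul_right, ← hA.isSymmetric,
    apply_apply_of_isSymmetricProjection hA, norm_smul β, mul_pow, Real.norm_eq_abs β, sq_abs]
  linarith

lemma apply_sub_smul_le_of_lipschitz [CompleteSpace E] {f : E → ℝ} {L η : ℝ}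
    (hf : Differentiable ℝ f) (hL : ∀ x y, ‖gradient f x - gradient f y‖ ≤ L * ‖x - y‖)
    (hη : 0 < η) (hηL : L * η ≤ 1 / 4) (x m : E) :
    f (x - η • m) ≤ f x - η / 2 * ‖gradient f x‖ ^ 2 - 3 / (8 * η) * ‖η • m‖ ^ 2
      + η / 2 * ‖m - gradient f x‖ ^ 2 := by
  have hdescent := le_add_inner_gradient_add_of_lipschitz hf hL x (-(η • m))
  have hsmooth : L * η * (η * ‖m‖ ^ 2) ≤ 1 / 4 * (η * ‖m‖ ^ 2) := by gcongr
  have hcancel : 3 / (8 * η) * (η ^ 2 * ‖m‖ ^ 2) = 3 / 8 * η * ‖m‖ ^ 2 := by field_simp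
  rw [← sub_eq_add_neg, norm_neg, inner_neg_right, real_inner_smul_right] at hdescent
  rw [norm_smul, mul_pow, Real.norm_eq_abs, sq_abs] at hdescent ⊢
  rw [norm_sub_rev m, norm_sub_sq_real, hcancel]
  linarith

/-- Two applications of the weighted triangle inequality with weight `δ / 4` lose only half of the
contraction `1 - δ`. -/
lemma weighted_contraction_le {δ G R : ℝ} (hδ : 0 < δ) (hG : 0 ≤ G) (hR : 0 ≤ R) :
    (1 + δ / 4) * ((1 - δ) * ((1 + δ / 4) * G + (1 + 1 / (δ / 4)) * R)) + (1 + 1 / (δ / 4)) * R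
      ≤ (1 - δ / 2) * G + 8 / δ * R := by
  have hcoeffG : (1 + δ / 4) * ((1 - δ) * (1 + δ / 4)) ≤ 1 - δ / 2 := by
    nlinarith [pow_pos hδ 2, pow_pos hδ 3]
  have hcoeffR : (1 + δ / 4) * ((1 - δ) * (1 + 1 / (δ / 4))) + (1 + 1 / (δ / 4)) ≤ 8 / δ := by
    rw [le_div_iff₀ hδ]
    have : 1 / (δ / 4) * δ = 4 := by field_simp
    nlinarith [pow_pos hδ 2, pow_pos hδ 3]
  linarith [mul_le_mul_of_nonneg_right hcoeffG hG, mul_le_mul_of_nonneg_right hcoeffR hR]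

end General

section ProjectedMomentum

variable {E Ω : Type*} [NormedAddCommGroup E] [InnerProductSpace ℝ E] [CompleteSpace E]

/-- The error of the momentum as an estimate of the projected gradient. -/
noncomputable def trackingError (f : E → ℝ) (x M : ℕ → Ω → E) (A : ℕ → Ω → E →ₗ[ℝ] E) (t : ℕ)
    (ω : Ω) : E :=
  M (t + 1) ω - A t ω (gradient f (x t ω))

/-- The part of the gradient that the projection discards. -/
noncomputable def discardedGradient (f : E → ℝ) (x : ℕ → Ω → E) (A : ℕ → Ω → E →ₗ[ℝ] E) (t : ℕ)
    (ω : Ω) : E :=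
  gradient f (x t ω) - A t ω (gradient f (x t ω))

variable [MeasurableSpace E] [MeasurableSpace Ω]

/-- A process `x` driven by the momentum `M (t + 1) = A t ((1 - β) M t + β (∇f (x t) + ν t))`,
where `A t` is a random orthogonal projection refreshed every `τ` steps and `ν` is centred noise.
The last two fields are conditional on the integrability that follows from the other ones. -/
structure ProjectedMomentum (μ : Measure Ω) (f : E → ℝ) (L δ β η s : ℝ) (τ : ℕ) (x₀ : E)
    (x M ν : ℕ → Ω → E) (A : ℕ → Ω → E →ₗ[ℝ] E) : Prop where
  differentiable : Differentiable ℝ f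
  lipschitz : ∀ y z, ‖gradient f y - gradient f z‖ ≤ L * ‖y - z‖
  bddBelow : BddBelow (Set.range f)
  measurable_x : ∀ t, Measurable (x t)
  measurable_M : ∀ t, Measurable (M t)
  measurable_A : ∀ t (w : Ω → E), Measurable w → Measurable fun ω => A t ω (w ω)
  proj : ∀ᵐ ω ∂μ, ∀ t, (A t ω).IsSymmetricProjection
  held : ∀ t ω, ¬τ ∣ t + 1 → A (t + 1) ω = A t ω
  x_zero : ∀ ω, x 0 ω = x₀
  x_succ : ∀ t ω, x (t + 1) ω = x t ω - η • M (t + 1) ω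
  M_zero : ∀ ω, M 0 ω = 0
  M_succ : ∀ᵐ ω ∂μ, ∀ t, M (t + 1) ω
    = A t ω ((1 - β) • M t ω + β • (gradient f (x t ω) + ν t ω))
  memLp_noise : ∀ t, MemLp (ν t) 2 μ
  noise_sq_le : ∀ t, ∫ ω, ‖ν t ω‖ ^ 2 ∂μ ≤ s ^ 2
  noise_orthogonal : ∀ t, MemLp (fun ω => A t ω (M t ω - gradient f (x t ω))) 2 μ →
    ∫ ω, inner ℝ (A t ω (M t ω - gradient f (x t ω))) (ν t ω) ∂μ = 0
  energy_le : ∀ k, MemLp (fun ω => gradient f (x (k * τ) ω)) 2 μ →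
    δ * ∫ ω, ‖gradient f (x (k * τ) ω)‖ ^ 2 ∂μ
      ≤ ∫ ω, ‖A (k * τ) ω (gradient f (x (k * τ) ω))‖ ^ 2 ∂μ

namespace ProjectedMomentum

variable {μ : Measure Ω} {f : E → ℝ} {L δ β η s : ℝ} {τ : ℕ} {x₀ : E} {x M ν : ℕ → Ω → E}
  {A : ℕ → Ω → E →ₗ[ℝ] E} (h : ProjectedMomentum μ f L δ β η s τ x₀ x M ν A)
include h

lemma held_add {j : ℕ} (hj : j < τ) (k : ℕ) (ω : Ω) : A (k * τ + j) ω = A (k * τ) ω := by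
  induction j with
  | zero => rfl
  | succ j ih =>
    rw [← ih (by omega), ← add_assoc, h.held]
    rw [dvd_mul_add_add_one_iff (by omega)]
    omega

lemma apply_M_succ : ∀ᵐ ω ∂μ, ∀ t, A t ω (M (t + 1) ω) = M (t + 1) ω := by
  filter_upwards [h.proj, h.M_succ] with ω hproj hM t
  rw [hM t, apply_apply_of_isSymmetricProjection (hproj t)]

lemma norm_M_sub_gradient_sq : ∀ᵐ ω ∂μ, ∀ t, ‖M (t + 1) ω - gradient f (x t ω)‖ ^ 2
    = ‖trackingError f x M A t ω‖ ^ 2 + ‖discardedGradient f x A t ω‖ ^ 2 := by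
  filter_upwards [h.proj, h.apply_M_succ] with ω hproj hM t
  exact norm_sub_sq_of_apply_eq (hproj t) (hM t) _

/-- A refresh of the projection turns the gradient discarded so far into error of the momentum. -/
lemma norm_apply_M_sub_gradient_sq_le : ∀ᵐ ω ∂μ, ∀ t,
    ‖A (t + 1) ω (M (t + 1) ω - gradient f (x t ω))‖ ^ 2
      ≤ ‖trackingError f x M A t ω‖ ^ 2
        + if τ ∣ t + 1 then ‖discardedGradient f x A t ω‖ ^ 2 else 0 := by
  filter_upwards [h.proj, h.apply_M_succ, h.norm_M_sub_gradient_sq] with ω hproj hM hsplit t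
  split_ifs with hdvd
  · rw [← hsplit]
    gcongr
    exact norm_apply_le_of_isSymmetricProjection (hproj _) _
  · rw [h.held t ω hdvd, map_sub, hM, add_zero, trackingError]

lemma norm_smul_apply_M_sub_gradient_succ_sq_le (hβ : 0 < β) (hβ1 : β ≤ 1) : ∀ᵐ ω ∂μ, ∀ t,
    ‖(1 - β) • A (t + 1) ω (M (t + 1) ω - gradient f (x (t + 1) ω))‖ ^ 2
      ≤ (1 - β) * (‖trackingError f x M A t ω‖ ^ 2
          + if τ ∣ t + 1 then ‖discardedGradient f x A t ω‖ ^ 2 else 0)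
        + L ^ 2 / β * ‖x (t + 1) ω - x t ω‖ ^ 2 := by
  filter_upwards [h.proj, h.norm_apply_M_sub_gradient_sq_le] with ω hproj hrefresh t
  have hsplit : A (t + 1) ω (M (t + 1) ω - gradient f (x (t + 1) ω))
      = A (t + 1) ω (M (t + 1) ω - gradient f (x t ω))
        + A (t + 1) ω (gradient f (x t ω) - gradient f (x (t + 1) ω)) := by
    rw [← map_add, sub_add_sub_cancel]
  have hdrift : ‖A (t + 1) ω (gradient f (x t ω) - gradient f (x (t + 1) ω))‖ ^ 2
      ≤ L ^ 2 * ‖x (t + 1) ω - x t ω‖ ^ 2 := by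
    rw [← mul_pow, norm_sub_rev (x (t + 1) ω)]
    gcongr
    exact (norm_apply_le_of_isSymmetricProjection (hproj _) _).trans (h.lipschitz _ _)
  have hβ' : 0 ≤ 1 - β := sub_nonneg.2 hβ1
  rw [hsplit]
  calc _ ≤ (1 - β) * ‖A (t + 1) ω (M (t + 1) ω - gradient f (x t ω))‖ ^ 2
        + 1 / β * ‖A (t + 1) ω (gradient f (x t ω) - gradient f (x (t + 1) ω))‖ ^ 2 :=
        norm_smul_add_sq_le hβ hβ1 _ _
    _ ≤ (1 - β) * (‖trackingError f x M A t ω‖ ^ 2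
          + if τ ∣ t + 1 then ‖discardedGradient f x A t ω‖ ^ 2 else 0)
        + 1 / β * (L ^ 2 * ‖x (t + 1) ω - x t ω‖ ^ 2) :=
        add_le_add (mul_le_mul_of_nonneg_left (hrefresh t) hβ')
          (mul_le_mul_of_nonneg_left hdrift (by positivity))
    _ = _ := by ring

variable [BorelSpace E]

lemma measurable_gradient_x (t : ℕ) : Measurable fun ω => gradient f (x t ω) :=
  (continuous_gradient_of_lipschitz h.lipschitz).measurable.comp (h.measurable_x t)

variable [SecondCountableTopology E]

lemma memLp_apply (t : ℕ) {w : Ω → E} (hm : Measurable w) (hw : MemLp w 2 μ) :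
    MemLp (fun ω => A t ω (w ω)) 2 μ :=
  hw.of_le (h.measurable_A t w hm).aestronglyMeasurable
    (h.proj.mono fun _ hω => norm_apply_le_of_isSymmetricProjection (hω t) _)

variable [IsFiniteMeasure μ]

lemma memLp_gradient_of_memLp {t : ℕ} (hx : MemLp (x t) 2 μ) :
    MemLp (fun ω => gradient f (x t ω)) 2 μ := by
  have hsub : MemLp (fun ω => gradient f (x t ω) - gradient f x₀) 2 μ :=
    (hx.sub (memLp_const x₀)).of_le_mul (c := L)
      ((h.measurable_gradient_x t).sub_const _).aestronglyMeasurable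
      (Filter.Eventually.of_forall fun _ => h.lipschitz _ _)
  simpa [Pi.add_def] using hsub.add (memLp_const (gradient f x₀))

lemma memLp_x_M (t : ℕ) : MemLp (x t) 2 μ ∧ MemLp (M t) 2 μ := by
  induction t with
  | zero =>
    rw [show x 0 = fun _ => x₀ from funext h.x_zero, show M 0 = fun _ => 0 from funext h.M_zero]
    exact ⟨memLp_const _, memLp_const _⟩
  | succ t ih =>
    have hw : MemLp (fun ω => (1 - β) • M t ω + β • (gradient f (x t ω) + ν t ω)) 2 μ :=
      (ih.2.const_smul (1 - β)).add
        (((h.memLp_gradient_of_memLp ih.1).add (h.memLp_noise t)).const_smul β)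
    have hM : MemLp (M (t + 1)) 2 μ := by
      refine hw.of_le (h.measurable_M _).aestronglyMeasurable ?_
      filter_upwards [h.proj, h.M_succ] with ω hproj hM
      rw [hM t]
      exact norm_apply_le_of_isSymmetricProjection (hproj t) _
    refine ⟨?_, hM⟩
    rw [show x (t + 1) = fun ω => x t ω - η • M (t + 1) ω from funext (h.x_succ t)]
    exact ih.1.sub (hM.const_smul η)

lemma memLp_gradient (t : ℕ) : MemLp (fun ω => gradient f (x t ω)) 2 μ :=
  h.memLp_gradient_of_memLp (h.memLp_x_M t).1

lemma memLp_apply_gradient (t : ℕ) : MemLp (fun ω => A t ω (gradient f (x t ω))) 2 μ :=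
  h.memLp_apply t (h.measurable_gradient_x t) (h.memLp_gradient t)

lemma memLp_apply_M_sub_gradient (t : ℕ) :
    MemLp (fun ω => A t ω (M t ω - gradient f (x t ω))) 2 μ :=
  h.memLp_apply t ((h.measurable_M t).sub (h.measurable_gradient_x t))
    ((h.memLp_x_M t).2.sub (h.memLp_gradient t))

lemma memLp_displacement (t : ℕ) : MemLp (fun ω => x (t + 1) ω - x t ω) 2 μ :=
  (h.memLp_x_M (t + 1)).1.sub (h.memLp_x_M t).1

lemma memLp_trackingError (t : ℕ) : MemLp (trackingError f x M A t) 2 μ :=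
  (h.memLp_x_M (t + 1)).2.sub (h.memLp_apply_gradient t)

lemma memLp_discardedGradient (t : ℕ) : MemLp (discardedGradient f x A t) 2 μ :=
  (h.memLp_gradient t).sub (h.memLp_apply_gradient t)

lemma memLp_gradient_sub_gradient (a t : ℕ) :
    MemLp (fun ω => gradient f (x t ω) - gradient f (x a ω)) 2 μ :=
  (h.memLp_gradient t).sub (h.memLp_gradient a)

lemma integral_trackingError_sq_le (t : ℕ) :
    ∫ ω, ‖trackingError f x M A t ω‖ ^ 2 ∂μ
      ≤ ∫ ω, ‖(1 - β) • A t ω (M t ω - gradient f (x t ω))‖ ^ 2 ∂μ + β ^ 2 * s ^ 2 := by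
  have hw := h.memLp_apply_M_sub_gradient t
  have hsq : Integrable (fun ω => ‖(1 - β) • A t ω (M t ω - gradient f (x t ω))‖ ^ 2) μ :=
    integrable_norm_sq_of_memLp_two (hw.const_smul (1 - β))
  have hinner := (integrable_inner_of_memLp_two hw (h.memLp_noise t)).const_mul
    (2 * (1 - β) * β)
  have hnoise := (integrable_norm_sq_of_memLp_two (h.memLp_noise t)).const_mul (β ^ 2)
  calc _ ≤ ∫ ω, (‖(1 - β) • A t ω (M t ω - gradient f (x t ω))‖ ^ 2
        + 2 * (1 - β) * β * inner ℝ (A t ω (M t ω - gradient f (x t ω))) (ν t ω)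
        + β ^ 2 * ‖ν t ω‖ ^ 2) ∂μ := by
        refine integral_mono_ae (integrable_norm_sq_of_memLp_two (h.memLp_trackingError t))
          ((hsq.fun_add hinner).fun_add hnoise) ?_
        filter_upwards [h.proj, h.M_succ] with ω hproj hM
        rw [trackingError, hM t]
        exact norm_apply_momentum_sub_apply_sq_le (hproj t) β _ _ _
    _ = ∫ ω, ‖(1 - β) • A t ω (M t ω - gradient f (x t ω))‖ ^ 2 ∂μ
        + β ^ 2 * ∫ ω, ‖ν t ω‖ ^ 2 ∂μ := by
        rw [integral_add (hsq.fun_add hinner) hnoise, integral_add hsq hinner, integral_const_mul,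
          integral_const_mul, h.noise_orthogonal t hw, mul_zero, add_zero]
    _ ≤ _ := by
        gcongr
        exact h.noise_sq_le t

lemma integral_trackingError_zero_sq_le (hβ : 0 ≤ β) (hβ1 : β ≤ 1) :
    ∫ ω, ‖trackingError f x M A 0 ω‖ ^ 2 ∂μ
      ≤ ∫ ω, ‖gradient f (x 0 ω)‖ ^ 2 ∂μ + β ^ 2 * s ^ 2 := by
  refine (h.integral_trackingError_sq_le 0).trans (add_le_add_left ?_ _)
  refine integral_mono_of_nonneg (Filter.Eventually.of_forall fun _ => by positivity)
    (integrable_norm_sq_of_memLp_two (h.memLp_gradient 0)) ?_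
  filter_upwards [h.proj] with ω hproj
  rw [h.M_zero, zero_sub, map_neg, smul_neg, norm_neg, norm_smul, Real.norm_eq_abs,
    abs_of_nonneg (by linarith)]
  gcongr
  exact (mul_le_of_le_one_left (norm_nonneg _) (by linarith)).trans
    (norm_apply_le_of_isSymmetricProjection (hproj 0) _)

lemma integral_trackingError_succ_sq_le (hβ : 0 < β) (hβ1 : β ≤ 1) (t : ℕ) :
    ∫ ω, ‖trackingError f x M A (t + 1) ω‖ ^ 2 ∂μ
      ≤ (1 - β) * (∫ ω, ‖trackingError f x M A t ω‖ ^ 2 ∂μ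
          + if τ ∣ t + 1 then ∫ ω, ‖discardedGradient f x A t ω‖ ^ 2 ∂μ else 0)
        + L ^ 2 / β * ∫ ω, ‖x (t + 1) ω - x t ω‖ ^ 2 ∂μ + β ^ 2 * s ^ 2 := by
  refine (h.integral_trackingError_sq_le (t + 1)).trans (add_le_add_left ?_ _)
  have herror := integrable_norm_sq_of_memLp_two (h.memLp_trackingError t)
  have hdiscarded : Integrable
      (fun ω => if τ ∣ t + 1 then ‖discardedGradient f x A t ω‖ ^ 2 else 0) μ := by
    split_ifs
    · exact integrable_norm_sq_of_memLp_two (h.memLp_discardedGradient t)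
    · exact integrable_zero _ _ _
  have hite : (if τ ∣ t + 1 then ∫ ω, ‖discardedGradient f x A t ω‖ ^ 2 ∂μ else 0)
      = ∫ ω, (if τ ∣ t + 1 then ‖discardedGradient f x A t ω‖ ^ 2 else 0) ∂μ := by
    split_ifs
    · rfl
    · exact integral_zero _ _ |>.symm
  rw [hite, ← integral_add herror hdiscarded]
  refine integral_le_linear_combination
    (integrable_norm_sq_of_memLp_two ((h.memLp_apply_M_sub_gradient (t + 1)).const_smul (1 - β)))
    (herror.add hdiscarded) (integrable_norm_sq_of_memLp_two (h.memLp_displacement t)) _ _ ?_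
  filter_upwards [h.norm_smul_apply_M_sub_gradient_succ_sq_le hβ hβ1] with ω hω
  exact hω t

lemma integrable_loss (t : ℕ) : Integrable (fun ω => f (x t ω)) μ := by
  obtain ⟨c, hc⟩ := h.bddBelow
  have hdx : MemLp (fun ω => x t ω - x₀) 2 μ := (h.memLp_x_M t).1.sub (memLp_const x₀)
  have hupper : Integrable (fun ω => f x₀ + inner ℝ (gradient f x₀) (x t ω - x₀)
      + L / 2 * ‖x t ω - x₀‖ ^ 2) μ :=
    ((integrable_const _).add ((hdx.integrable one_le_two).const_inner _)).add
      ((integrable_norm_sq_of_memLp_two hdx).const_mul _)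
  refine integrable_of_le_of_le
    (h.differentiable.continuous.measurable.comp (h.measurable_x t)).aestronglyMeasurable
    (Filter.Eventually.of_forall fun ω => hc ⟨_, rfl⟩)
    (Filter.Eventually.of_forall fun ω => ?_) (integrable_const c) hupper
  simpa using
    le_add_inner_gradient_add_of_lipschitz h.differentiable h.lipschitz x₀ (x t ω - x₀)

lemma integral_loss_succ_le (hη : 0 < η) (hηL : L * η ≤ 1 / 4) (t : ℕ) :
    ∫ ω, f (x (t + 1) ω) ∂μ ≤ ∫ ω, f (x t ω) ∂μ
      - η / 2 * ∫ ω, ‖gradient f (x t ω)‖ ^ 2 ∂μ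
      - 3 / (8 * η) * ∫ ω, ‖x (t + 1) ω - x t ω‖ ^ 2 ∂μ
      + η / 2 * (∫ ω, ‖trackingError f x M A t ω‖ ^ 2 ∂μ
        + ∫ ω, ‖discardedGradient f x A t ω‖ ^ 2 ∂μ) := by
  have hloss := h.integrable_loss t
  have hgrad := (integrable_norm_sq_of_memLp_two (h.memLp_gradient t)).const_mul (η / 2)
  have hdisp := (integrable_norm_sq_of_memLp_two (h.memLp_displacement t)).const_mul (3 / (8 * η))
  have herror := integrable_norm_sq_of_memLp_two (h.memLp_trackingError t)
  have hdiscarded := integrable_norm_sq_of_memLp_two (h.memLp_discardedGradient t)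
  have hestimate := (herror.fun_add hdiscarded).const_mul (η / 2)
  have hdecrease : Integrable (fun ω => f (x t ω) - η / 2 * ‖gradient f (x t ω)‖ ^ 2) μ :=
    hloss.sub hgrad
  have hrest : Integrable (fun ω => f (x t ω) - η / 2 * ‖gradient f (x t ω)‖ ^ 2
      - 3 / (8 * η) * ‖x (t + 1) ω - x t ω‖ ^ 2) μ := hdecrease.sub hdisp
  rw [← integral_add herror hdiscarded, ← integral_const_mul, ← integral_const_mul,
    ← integral_const_mul, ← integral_sub hloss hgrad, ← integral_sub hdecrease hdisp,
    ← integral_add hrest hestimate]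
  refine integral_mono_ae (h.integrable_loss (t + 1)) (hrest.fun_add hestimate) ?_
  filter_upwards [h.norm_M_sub_gradient_sq] with ω hsplit
  have hdescent := apply_sub_smul_le_of_lipschitz h.differentiable h.lipschitz hη hηL
    (x t ω) (M (t + 1) ω)
  have hstep : x (t + 1) ω - x t ω = -(η • M (t + 1) ω) := by
    rw [h.x_succ]
    abel
  rwa [hsplit, ← norm_neg (η • M (t + 1) ω), ← hstep, ← h.x_succ] at hdescent

lemma integral_discardedGradient_sq_le (t : ℕ) :
    ∫ ω, ‖discardedGradient f x A t ω‖ ^ 2 ∂μ ≤ ∫ ω, ‖gradient f (x t ω)‖ ^ 2 ∂μ := by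
  refine integral_mono_ae (integrable_norm_sq_of_memLp_two (h.memLp_discardedGradient t))
    (integrable_norm_sq_of_memLp_two (h.memLp_gradient t)) ?_
  filter_upwards [h.proj] with ω hproj
  gcongr
  exact norm_sub_apply_le_of_isSymmetricProjection (hproj t) _

lemma integral_discardedGradient_period_start_sq_le (k : ℕ) :
    ∫ ω, ‖discardedGradient f x A (k * τ) ω‖ ^ 2 ∂μ
      ≤ (1 - δ) * ∫ ω, ‖gradient f (x (k * τ) ω)‖ ^ 2 ∂μ := by
  have hpyth : ∫ ω, ‖discardedGradient f x A (k * τ) ω‖ ^ 2 ∂μ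
      = ∫ ω, (‖gradient f (x (k * τ) ω)‖ ^ 2
        - ‖A (k * τ) ω (gradient f (x (k * τ) ω))‖ ^ 2) ∂μ := by
    refine integral_congr_ae ?_
    filter_upwards [h.proj] with ω hproj
    exact eq_sub_of_add_eq' (norm_apply_sq_add_norm_sub_apply_sq (hproj (k * τ)) _)
  rw [hpyth, integral_sub (integrable_norm_sq_of_memLp_two (h.memLp_gradient (k * τ)))
    (integrable_norm_sq_of_memLp_two (h.memLp_apply_gradient (k * τ)))]
  linarith [h.energy_le k (h.memLp_gradient _)]

lemma integral_gradient_sub_gradient_sq_le (a j : ℕ) :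
    ∫ ω, ‖gradient f (x (a + j) ω) - gradient f (x a ω)‖ ^ 2 ∂μ
      ≤ L ^ 2 * (j * ∑ i ∈ Finset.range j, ∫ ω, ‖x (a + i + 1) ω - x (a + i) ω‖ ^ 2 ∂μ) := by
  have hint : ∀ i ∈ Finset.range j, Integrable (fun ω => ‖x (a + i + 1) ω - x (a + i) ω‖ ^ 2) μ :=
    fun i _ => integrable_norm_sq_of_memLp_two (h.memLp_displacement (a + i))
  rw [← integral_finsetSum _ hint, ← integral_const_mul, ← integral_const_mul]
  refine integral_mono_ae (integrable_norm_sq_of_memLp_two (h.memLp_gradient_sub_gradient _ _))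
    (((integrable_finsetSum _ hint).const_mul _).const_mul _)
    (Filter.Eventually.of_forall fun ω => ?_)
  calc ‖gradient f (x (a + j) ω) - gradient f (x a ω)‖ ^ 2
      ≤ (L * ‖x (a + j) ω - x a ω‖) ^ 2 := by
        gcongr
        exact h.lipschitz _ _
    _ = L ^ 2 * ‖x (a + j) ω - x a ω‖ ^ 2 := mul_pow _ _ _
    _ ≤ _ := mul_le_mul_of_nonneg_left (norm_sub_sq_le_mul_sum (fun t => x t ω) a j) (sq_nonneg L)

lemma integral_gradient_sq_le_weighted {c : ℝ} (hc : 0 < c) (s t : ℕ) :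
    ∫ ω, ‖gradient f (x s ω)‖ ^ 2 ∂μ ≤ (1 + c) * ∫ ω, ‖gradient f (x t ω)‖ ^ 2 ∂μ
      + (1 + 1 / c) * ∫ ω, ‖gradient f (x s ω) - gradient f (x t ω)‖ ^ 2 ∂μ := by
  refine integral_le_linear_combination (integrable_norm_sq_of_memLp_two (h.memLp_gradient s))
    (integrable_norm_sq_of_memLp_two (h.memLp_gradient t))
    (integrable_norm_sq_of_memLp_two (h.memLp_gradient_sub_gradient t s)) _ _
    (Filter.Eventually.of_forall fun ω => ?_)
  simpa using norm_add_sq_le_weighted hc (gradient f (x t ω))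
    (gradient f (x s ω) - gradient f (x t ω))

lemma integral_discardedGradient_sq_le_weighted {c : ℝ} (hc : 0 < c) {s t : ℕ}
    (hst : ∀ ω, A t ω = A s ω) :
    ∫ ω, ‖discardedGradient f x A t ω‖ ^ 2 ∂μ
      ≤ (1 + c) * ∫ ω, ‖discardedGradient f x A s ω‖ ^ 2 ∂μ
        + (1 + 1 / c) * ∫ ω, ‖gradient f (x t ω) - gradient f (x s ω)‖ ^ 2 ∂μ := by
  refine integral_le_linear_combination
    (integrable_norm_sq_of_memLp_two (h.memLp_discardedGradient t))
    (integrable_norm_sq_of_memLp_two (h.memLp_discardedGradient s))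
    (integrable_norm_sq_of_memLp_two (h.memLp_gradient_sub_gradient s t)) _ _ ?_
  filter_upwards [h.proj] with ω hproj
  set d := gradient f (x t ω) - gradient f (x s ω) with hd
  have hsplit : discardedGradient f x A t ω = discardedGradient f x A s ω + (d - A s ω d) := by
    rw [discardedGradient, discardedGradient, hst, hd, map_sub]
    abel
  rw [hsplit]
  refine (norm_add_sq_le_weighted hc _ _).trans ?_
  gcongr
  exact norm_sub_apply_le_of_isSymmetricProjection (hproj s) _

lemma integral_discardedGradient_period_sq_le (hδ : 0 < δ) (hδ1 : δ ≤ 1) (k j : ℕ) (hj : j < τ) :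
    ∫ ω, ‖discardedGradient f x A (k * τ + j) ω‖ ^ 2 ∂μ
      ≤ (1 - δ / 2) * ∫ ω, ‖gradient f (x (k * τ + j) ω)‖ ^ 2 ∂μ
        + 8 / δ * L ^ 2 * (j * ∑ i ∈ Finset.range j,
          ∫ ω, ‖x (k * τ + i + 1) ω - x (k * τ + i) ω‖ ^ 2 ∂μ) := by
  have hheld := h.integral_discardedGradient_sq_le_weighted (c := δ / 4) (by positivity)
    (h.held_add hj k)
  have hstart := h.integral_discardedGradient_period_start_sq_le k
  have hback := h.integral_gradient_sq_le_weighted (c := δ / 4) (by positivity)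
    (k * τ) (k * τ + j)
  have hdist := h.integral_gradient_sub_gradient_sq_le (k * τ) j
  simp only [norm_sub_rev (gradient f (x (k * τ) _))] at hback
  set R := ∫ ω, ‖gradient f (x (k * τ + j) ω) - gradient f (x (k * τ) ω)‖ ^ 2 ∂μ
  set G := ∫ ω, ‖gradient f (x (k * τ + j) ω)‖ ^ 2 ∂μ
  set S := ∑ i ∈ Finset.range j, ∫ ω, ‖x (k * τ + i + 1) ω - x (k * τ + i) ω‖ ^ 2 ∂μ
  have : 0 ≤ 1 - δ := sub_nonneg.2 hδ1
  calc _ ≤ (1 + δ / 4) * ∫ ω, ‖discardedGradient f x A (k * τ) ω‖ ^ 2 ∂μ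
        + (1 + 1 / (δ / 4)) * R := hheld
    _ ≤ (1 + δ / 4) * ((1 - δ) * ((1 + δ / 4) * G + (1 + 1 / (δ / 4)) * R))
        + (1 + 1 / (δ / 4)) * R := by
        gcongr
        exact hstart.trans (by gcongr)
    _ ≤ (1 - δ / 2) * G + 8 / δ * R := weighted_contraction_le hδ
        (integral_nonneg fun _ => by positivity) (integral_nonneg fun _ => by positivity)
    _ ≤ (1 - δ / 2) * G + 8 / δ * (L ^ 2 * (j * S)) := by gcongr
    _ = _ := by ring

lemma integral_gradient_sub_gradient_period_sq_le {i j : ℕ} (hij : i ≤ j) (hj : j < τ) (k : ℕ) :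
    ∫ ω, ‖gradient f (x (k * τ + j) ω) - gradient f (x (k * τ + i) ω)‖ ^ 2 ∂μ
      ≤ L ^ 2 * (τ * ∑ i ∈ Finset.range τ,
        ∫ ω, ‖x (k * τ + i + 1) ω - x (k * τ + i) ω‖ ^ 2 ∂μ) := by
  obtain ⟨l, rfl⟩ := Nat.exists_eq_add_of_le hij
  have hnonneg : ∀ a, 0 ≤ ∫ ω, ‖x (a + 1) ω - x a ω‖ ^ 2 ∂μ :=
    fun a => integral_nonneg fun _ => by positivity
  have hsum : ∑ a ∈ Finset.range l, ∫ ω, ‖x (k * τ + i + a + 1) ω - x (k * τ + i + a) ω‖ ^ 2 ∂μ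
      ≤ ∑ a ∈ Finset.range τ, ∫ ω, ‖x (k * τ + a + 1) ω - x (k * τ + a) ω‖ ^ 2 ∂μ := by
    calc _ = ∑ a ∈ Finset.Ico i (i + l),
          ∫ ω, ‖x (k * τ + a + 1) ω - x (k * τ + a) ω‖ ^ 2 ∂μ := by
          rw [Finset.sum_Ico_eq_sum_range]
          simp only [add_tsub_cancel_left, add_assoc]
      _ ≤ _ := by
          refine Finset.sum_le_sum_of_subset_of_nonneg (fun a ha => ?_) fun a _ _ => hnonneg _
          rw [Finset.mem_Ico] at ha
          rw [Finset.mem_range]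
          omega
  have hl : l ≤ τ := by omega
  rw [← add_assoc]
  refine (h.integral_gradient_sub_gradient_sq_le (k * τ + i) l).trans ?_
  gcongr

lemma integral_gradient_period_sq_le (k i j : ℕ) (hi : i < τ) (hj : j < τ) :
    ∫ ω, ‖gradient f (x (k * τ + i) ω)‖ ^ 2 ∂μ
      ≤ 4 * ∫ ω, ‖gradient f (x (k * τ + j) ω)‖ ^ 2 ∂μ
        + 4 / 3 * L ^ 2 * τ * ∑ i ∈ Finset.range τ,
          ∫ ω, ‖x (k * τ + i + 1) ω - x (k * τ + i) ω‖ ^ 2 ∂μ := by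
  have hweighted := h.integral_gradient_sq_le_weighted (c := 3) (by norm_num)
    (k * τ + i) (k * τ + j)
  have hdist : ∫ ω, ‖gradient f (x (k * τ + i) ω) - gradient f (x (k * τ + j) ω)‖ ^ 2 ∂μ
      ≤ L ^ 2 * (τ * ∑ i ∈ Finset.range τ,
        ∫ ω, ‖x (k * τ + i + 1) ω - x (k * τ + i) ω‖ ^ 2 ∂μ) := by
    rcases le_total i j with hij | hji
    · simp only [norm_sub_rev (gradient f (x (k * τ + i) _))]
      exact h.integral_gradient_sub_gradient_period_sq_le hij hj k
    · exact h.integral_gradient_sub_gradient_period_sq_le hji hi k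
  linarith

theorem scalarRecursion (ha : Admissible L δ β η τ) :
    ScalarRecursion L δ β η s τ (fun t => ∫ ω, ‖gradient f (x t ω)‖ ^ 2 ∂μ)
      (fun t => ∫ ω, ‖x (t + 1) ω - x t ω‖ ^ 2 ∂μ)
      (fun t => ∫ ω, ‖trackingError f x M A t ω‖ ^ 2 ∂μ)
      (fun t => ∫ ω, ‖discardedGradient f x A t ω‖ ^ 2 ∂μ)
      (fun t => ∫ ω, f (x t ω) ∂μ) where
  g_nonneg t := integral_nonneg fun _ => by positivity
  d_nonneg t := integral_nonneg fun _ => by positivity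
  u_nonneg t := integral_nonneg fun _ => by positivity
  v_le := h.integral_discardedGradient_sq_le
  descent := h.integral_loss_succ_le ha.η_pos ha.smoothness_mul_η_le
  u_zero := h.integral_trackingError_zero_sq_le ha.β_pos.le ha.β_le_one
  u_succ := h.integral_trackingError_succ_sq_le ha.β_pos ha.β_le_one
  v_period := h.integral_discardedGradient_period_sq_le ha.δ_pos ha.δ_le_one
  g_period := h.integral_gradient_period_sq_le

omit [IsFiniteMeasure μ] in
lemma integral_loss_zero_sub_le [IsProbabilityMeasure μ] (t : ℕ) :
    ∫ ω, f (x 0 ω) ∂μ - ∫ ω, f (x t ω) ∂μ ≤ f x₀ - ⨅ y, f y := by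
  have hzero : ∫ ω, f (x 0 ω) ∂μ = f x₀ := by simp [h.x_zero]
  have hlower : ⨅ y, f y ≤ ∫ ω, f (x t ω) ∂μ := by
    calc ⨅ y, f y = ∫ _, ⨅ y, f y ∂μ := by simp
      _ ≤ _ := integral_mono (integrable_const _) (h.integrable_loss t)
        fun _ => ciInf_le h.bddBelow _
  linarith

end ProjectedMomentum

end ProjectedMomentum

/-! ### Expectations of functions of independent variables -/

section Independence

variable {Ω α β γ : Type*} [MeasurableSpace Ω] [MeasurableSpace α] [MeasurableSpace β]
  [MeasurableSpace γ] {μ : Measure Ω} {X : Ω → α} {Y : Ω → β} {Z : Ω → γ}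

lemma indepFun_of_measurable_comap (hXY : IndepFun X Y μ)
    (hZ : Measurable[MeasurableSpace.comap Y inferInstance] Z) : IndepFun X Z μ :=
  indep_of_indep_of_le_right hXY hZ.comap_le

variable [IsFiniteMeasure μ]

lemma integral_comp_of_indepFun (hX : Measurable X) (hY : Measurable Y)
    (hXY : IndepFun X Y μ) {h : α × β → ℝ} (hm : Measurable h)
    (hint : Integrable (fun ω => h (X ω, Y ω)) μ) :
    ∫ ω, h (X ω, Y ω) ∂μ = ∫ ω, ∫ y, h (X ω, y) ∂(μ.map Y) ∂μ := by
  have hprod := hXY.map_prod_eq_prod_map_map hX.aemeasurable hY.aemeasurable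
  have hint' : Integrable h ((μ.map X).prod (μ.map Y)) := by
    rw [← hprod, integrable_map_measure hm.aestronglyMeasurable (hX.prodMk hY).aemeasurable]
    exact hint
  rw [← integral_map (φ := fun ω => (X ω, Y ω)) (hX.prodMk hY).aemeasurable
    hm.aestronglyMeasurable, hprod, integral_prod _ hint', integral_map hX.aemeasurable]
  exact hint'.aestronglyMeasurable.integral_prod_right'

variable {h : α × β → ℝ} {c : ℝ}

lemma integrable_comp_of_indepFun (hX : Measurable X) (hY : Measurable Y) (hXY : IndepFun X Y μ)
    (hm : Measurable h) (h0 : ∀ p, 0 ≤ h p) (hi : ∀ x, Integrable (fun y => h (x, y)) (μ.map Y))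
    (hc : ∀ x, ∫ y, h (x, y) ∂(μ.map Y) ≤ c) :
    Integrable (fun ω => h (X ω, Y ω)) μ := by
  rw [← Function.comp_def h, ← integrable_map_measure hm.aestronglyMeasurable
    (hX.prodMk hY).aemeasurable, hXY.map_prod_eq_prod_map_map hX.aemeasurable hY.aemeasurable,
    integrable_prod_iff hm.aestronglyMeasurable]
  refine ⟨.of_forall hi, (integrable_const c).mono'
    hm.aestronglyMeasurable.norm.integral_prod_right' (.of_forall fun x => ?_)⟩
  simp only [Real.norm_of_nonneg (h0 _)]
  rw [Real.norm_of_nonneg (integral_nonneg fun y => h0 _)]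
  exact hc x

lemma integral_comp_le_of_indepFun [IsProbabilityMeasure μ] (hX : Measurable X)
    (hY : Measurable Y) (hXY : IndepFun X Y μ) (hm : Measurable h) (h0 : ∀ p, 0 ≤ h p)
    (hi : ∀ x, Integrable (fun y => h (x, y)) (μ.map Y))
    (hc : ∀ x, ∫ y, h (x, y) ∂(μ.map Y) ≤ c) :
    ∫ ω, h (X ω, Y ω) ∂μ ≤ c := by
  rw [integral_comp_of_indepFun hX hY hXY hm (integrable_comp_of_indepFun hX hY hXY hm h0 hi hc)]
  calc ∫ ω, ∫ y, h (X ω, y) ∂(μ.map Y) ∂μ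
      ≤ ∫ _, c ∂μ := integral_mono_of_nonneg (.of_forall fun ω => integral_nonneg fun y => h0 _)
        (integrable_const _) (.of_forall fun ω => hc _)
    _ = c := by simp

lemma indepFun_prodMk_right (hX : Measurable X) (hY : Measurable Y) (hZ : Measurable Z)
    (hXY : IndepFun X Y μ) (hYZ : IndepFun Y Z μ)
    (hXYZ : IndepFun (fun ω => (X ω, Y ω)) Z μ) : IndepFun X (fun ω => (Y ω, Z ω)) μ := by
  rw [indepFun_iff_map_prod_eq_prod_map_map hX.aemeasurable (hY.prodMk hZ).aemeasurable,
    hYZ.map_prod_eq_prod_map_map hY.aemeasurable hZ.aemeasurable, ← Measure.prodAssoc_prod,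
    ← hXY.map_prod_eq_prod_map_map hX.aemeasurable hY.aemeasurable,
    ← hXYZ.map_prod_eq_prod_map_map (hX.prodMk hY).aemeasurable hZ.aemeasurable,
    Measure.map_map (MeasurableEquiv.measurable _) ((hX.prodMk hY).prodMk hZ)]
  rfl

end Independence

/-! ### Measurability of the run -/

section Held

variable {α : Type*} {τ t : ℕ}

lemma held_of_dvd (S : ℕ → α) (ht : τ ∣ t) : held τ S t = S t := by
  cases t with
  | zero => rfl
  | succ t => rw [held, if_pos ht]

lemma held_of_not_dvd (S : ℕ → α) (ht : ¬τ ∣ t) : held τ S t = held τ S (t - 1) := by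
  cases t with
  | zero => exact absurd (dvd_zero τ) ht
  | succ t => rw [held, if_neg ht, Nat.add_sub_cancel]

lemma exists_held_eq (α : Type*) (τ t : ℕ) : ∃ s ≤ t, ∀ S : ℕ → α, held τ S t = S s := by
  induction t with
  | zero => exact ⟨0, le_rfl, fun _ => rfl⟩
  | succ t ih =>
    by_cases ht : τ ∣ t + 1
    · exact ⟨t + 1, le_rfl, fun S => held_of_dvd S ht⟩
    · obtain ⟨s, hs, hheld⟩ := ih
      exact ⟨s, by lia, fun S => (held_of_not_dvd S ht).trans (hheld S)⟩

lemma measurable_held {Ω ι : Type*} [MeasurableSpace Ω] {β : ι → Type*}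
    [∀ i, MeasurableSpace (β i)] {S : ℕ → ∀ i, Ω → β i}
    (hS : ∀ s ≤ t, ∀ i, Measurable (S s i)) (i : ι) :
    Measurable fun ω => held τ (fun s i => S s i ω) t i := by
  obtain ⟨s, hs, hheld⟩ := exists_held_eq (∀ i, β i) τ t
  simp only [hheld]
  exact hS s hs i

end Held

section Measurability

instance instSecondCountableTopologyMatrix {a b : Type*} [Countable a] [Countable b] :
    SecondCountableTopology (Matrix a b ℝ) :=
  inferInstanceAs (SecondCountableTopology (a → b → ℝ))

variable {Ω : Type*} [MeasurableSpace Ω]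

lemma measurable_matrix_mul {a b c : ℕ} {A : Ω → Matrix (Fin a) (Fin b) ℝ}
    {B : Ω → Matrix (Fin b) (Fin c) ℝ} (hA : Measurable A) (hB : Measurable B) :
    Measurable fun ω => A ω * B ω :=
  (continuous_fst.matrix_mul continuous_snd).measurable.comp (hA.prodMk hB)

lemma measurable_matrix_transpose {a b : ℕ} {A : Ω → Matrix (Fin a) (Fin b) ℝ}
    (hA : Measurable A) : Measurable fun ω => (A ω)ᵀ :=
  continuous_id.matrix_transpose.measurable.comp hA

variable {N : ℕ} {m n r : Fin N → ℕ}

lemma measurable_block {v : Ω → Params m n} (hv : Measurable v) (ℓ : Fin N) :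
    Measurable fun ω => block (v ω) ℓ :=
  (continuous_block ℓ).measurable.comp hv

lemma measurable_of_block {v : Ω → Params m n} (hv : ∀ ℓ, Measurable fun ω => block (v ω) ℓ) :
    Measurable v :=
  (WithLp.measurable_toLp 2 _).comp <| measurable_pi_iff.2 fun p =>
    (continuous_id.matrix_elem p.2.1 p.2.2).measurable.comp (hv p.1)

variable {P P' : Ω → ∀ ℓ, Matrix (Fin (m ℓ)) (Fin (r ℓ)) ℝ}
  {Q Q' : Ω → ∀ ℓ, Matrix (Fin (n ℓ)) (Fin (r ℓ)) ℝ}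

lemma measurable_blockProj (hP : ∀ ℓ, Measurable fun ω => P ω ℓ)
    (hQ : ∀ ℓ, Measurable fun ω => Q ω ℓ) {v : Ω → Params m n} (hv : Measurable v) :
    Measurable fun ω => blockProj (P ω) (Q ω) (v ω) := by
  refine measurable_of_block fun ℓ => ?_
  by_cases hℓ : m ℓ ≤ n ℓ
  · simp only [block_blockProj, hℓ, if_true]
    exact measurable_matrix_mul (measurable_matrix_mul (hP ℓ) (measurable_matrix_transpose (hP ℓ)))
      (measurable_block hv ℓ)
  · simp only [block_blockProj, hℓ, if_false]
    exact measurable_matrix_mul (measurable_block hv ℓ)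
      (measurable_matrix_mul (hQ ℓ) (measurable_matrix_transpose (hQ ℓ)))

/-- All components of a random state are measurable. (`State` itself carries no σ-algebra.) -/
structure MeasurableState (s : Ω → State m n r) : Prop where
  x : Measurable fun ω => (s ω).x
  left : ∀ ℓ, Measurable fun ω => (s ω).left ℓ
  right : ∀ ℓ, Measurable fun ω => (s ω).right ℓ

lemma measurable_fullMomentum (hP : ∀ ℓ, Measurable fun ω => P ω ℓ)
    (hQ : ∀ ℓ, Measurable fun ω => Q ω ℓ) {s : Ω → State m n r}
    (hleft : ∀ ℓ, Measurable fun ω => (s ω).left ℓ)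
    (hright : ∀ ℓ, Measurable fun ω => (s ω).right ℓ) :
    Measurable fun ω => fullMomentum (P ω) (Q ω) (s ω) := by
  refine measurable_of_block fun ℓ => ?_
  by_cases hℓ : m ℓ ≤ n ℓ
  · simp only [block_fullMomentum, hℓ, if_true]
    exact measurable_matrix_mul (hP ℓ) (hleft ℓ)
  · simp only [block_fullMomentum, hℓ, if_false]
    exact measurable_matrix_mul (hright ℓ) (measurable_matrix_transpose (hQ ℓ))

variable {G : Ω → Params m n} {s : Ω → State m n r}

lemma measurable_step_left (β η : ℝ) (τ t : ℕ) (hP : ∀ ℓ, Measurable fun ω => P ω ℓ)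
    (hP' : ∀ ℓ, Measurable fun ω => P' ω ℓ) (hG : Measurable G)
    (hs : ∀ ℓ, Measurable fun ω => (s ω).left ℓ) (ℓ : Fin N) :
    Measurable fun ω => (step β η τ t (P ω) (P' ω) (Q ω) (Q' ω) (G ω) (s ω)).left ℓ := by
  have hnew := measurable_matrix_mul (measurable_matrix_transpose (hP ℓ)) (measurable_block hG ℓ)
  refine .add (.const_smul ?_ (1 - β)) (hnew.const_smul β)
  split_ifs
  · exact measurable_matrix_mul (measurable_matrix_mul (measurable_matrix_transpose (hP ℓ))
      (hP' ℓ)) (hs ℓ)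
  · exact hs ℓ

lemma measurable_step_right (β η : ℝ) (τ t : ℕ) (hQ : ∀ ℓ, Measurable fun ω => Q ω ℓ)
    (hQ' : ∀ ℓ, Measurable fun ω => Q' ω ℓ) (hG : Measurable G)
    (hs : ∀ ℓ, Measurable fun ω => (s ω).right ℓ) (ℓ : Fin N) :
    Measurable fun ω => (step β η τ t (P ω) (P' ω) (Q ω) (Q' ω) (G ω) (s ω)).right ℓ := by
  have hnew := measurable_matrix_mul (measurable_block hG ℓ) (hQ ℓ)
  refine .add (.const_smul ?_ (1 - β)) (hnew.const_smul β)
  split_ifs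
  · exact measurable_matrix_mul (measurable_matrix_mul (hs ℓ)
      (measurable_matrix_transpose (hQ' ℓ))) (hQ ℓ)
  · exact hs ℓ

lemma measurableState_step (β η : ℝ) (τ t : ℕ) (hP : ∀ ℓ, Measurable fun ω => P ω ℓ)
    (hP' : ∀ ℓ, Measurable fun ω => P' ω ℓ) (hQ : ∀ ℓ, Measurable fun ω => Q ω ℓ)
    (hQ' : ∀ ℓ, Measurable fun ω => Q' ω ℓ) (hG : Measurable G) (hs : MeasurableState s) :
    MeasurableState fun ω => step β η τ t (P ω) (P' ω) (Q ω) (Q' ω) (G ω) (s ω) := by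
  have hleft := measurable_step_left (Q := Q) (Q' := Q') β η τ t hP hP' hG hs.left
  have hright := measurable_step_right (P := P) (P' := P') β η τ t hQ hQ' hG hs.right
  refine ⟨?_, hleft, hright⟩
  simp only [step_x]
  exact hs.x.sub ((measurable_fullMomentum hP hQ hleft hright).const_smul η)

lemma measurableState_run {Ξ : Type*} [MeasurableSpace Ξ] {F : Params m n → Ξ → ℝ}
    (hF : Measurable fun p : Params m n × Ξ => stochGrad F p.1 p.2) (β η : ℝ) (τ : ℕ)
    (x₀ : Params m n) {ξ : ℕ → Ω → Ξ}
    {P : ℕ → ∀ ℓ, Ω → Matrix (Fin (m ℓ)) (Fin (r ℓ)) ℝ}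
    {Q : ℕ → ∀ ℓ, Ω → Matrix (Fin (n ℓ)) (Fin (r ℓ)) ℝ} {t : ℕ}
    (hξ : ∀ s < t, Measurable (ξ s)) (hP : ∀ s < t, ∀ ℓ, Measurable (P s ℓ))
    (hQ : ∀ s < t, ∀ ℓ, Measurable (Q s ℓ)) :
    MeasurableState fun ω => run F β η τ x₀ (fun s => ξ s ω) (fun s ℓ => P s ℓ ω)
      (fun s ℓ => Q s ℓ ω) t := by
  induction t with
  | zero => exact ⟨measurable_const, fun ℓ => measurable_const, fun ℓ => measurable_const⟩
  | succ t ih =>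
    have hs := ih (fun s hs => hξ s (by lia)) (fun s hs => hP s (by lia))
      (fun s hs => hQ s (by lia))
    exact measurableState_step β η τ t
      (measurable_held fun s hs => hP s (by lia)) (measurable_held fun s hs => hP s (by lia))
      (measurable_held fun s hs => hQ s (by lia)) (measurable_held fun s hs => hQ s (by lia))
      (hF.comp (hs.x.prodMk (hξ t (by lia)))) hs

end Measurability

/-! ### The run of GoLore in the full parameter space -/

section Run

variable {N : ℕ} {m n r : Fin N → ℕ} {Ω Ξ : Type*}

/-- The blockwise projection in use at time `t`. -/
noncomputable def projAt (τ : ℕ) (P : ℕ → ∀ ℓ, Ω → Matrix (Fin (m ℓ)) (Fin (r ℓ)) ℝ)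
    (Q : ℕ → ∀ ℓ, Ω → Matrix (Fin (n ℓ)) (Fin (r ℓ)) ℝ) (t : ℕ) (ω : Ω) :
    Params m n →ₗ[ℝ] Params m n :=
  blockProj (held τ (fun s ℓ => P s ℓ ω) t) (held τ (fun s ℓ => Q s ℓ ω) t)

/-- The momentum `M^(t-1)` entering step `t`, lifted to the parameter space. It is lifted by the
projections of time `t - 1`; at `t = 0` it is zero, so that the truncated subtraction is
harmless. -/
noncomputable def momentumAt (F : Params m n → Ξ → ℝ) (β η : ℝ) (τ : ℕ) (x₀ : Params m n)
    (ξ : ℕ → Ω → Ξ) (P : ℕ → ∀ ℓ, Ω → Matrix (Fin (m ℓ)) (Fin (r ℓ)) ℝ)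
    (Q : ℕ → ∀ ℓ, Ω → Matrix (Fin (n ℓ)) (Fin (r ℓ)) ℝ) (t : ℕ) (ω : Ω) : Params m n :=
  fullMomentum (held τ (fun s ℓ => P s ℓ ω) (t - 1)) (held τ (fun s ℓ => Q s ℓ ω) (t - 1))
    (run F β η τ x₀ (fun s => ξ s ω) (fun s ℓ => P s ℓ ω) (fun s ℓ => Q s ℓ ω) t)

variable (F : Params m n → Ξ → ℝ) (β η : ℝ) {τ : ℕ} (x₀ : Params m n) (ξ : ℕ → Ω → Ξ)
  {P : ℕ → ∀ ℓ, Ω → Matrix (Fin (m ℓ)) (Fin (r ℓ)) ℝ}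
  {Q : ℕ → ∀ ℓ, Ω → Matrix (Fin (n ℓ)) (Fin (r ℓ)) ℝ} {ω : Ω}

lemma projAt_of_dvd {t : ℕ} (ht : τ ∣ t) :
    projAt τ P Q t ω = blockProj (fun ℓ => P t ℓ ω) (fun ℓ => Q t ℓ ω) := by
  rw [projAt, held_of_dvd _ ht, held_of_dvd _ ht]

lemma projAt_add_one_of_not_dvd {t : ℕ} (ht : ¬τ ∣ t + 1) :
    projAt τ P Q (t + 1) ω = projAt τ P Q t ω := by
  rw [projAt, held_of_not_dvd _ ht, held_of_not_dvd _ ht, Nat.add_sub_cancel, ← projAt]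

lemma orthonormalColumns_held
    (hω : ∀ t, OrthonormalColumns (fun ℓ => P t ℓ ω) (fun ℓ => Q t ℓ ω)) (t : ℕ) :
    OrthonormalColumns (held τ (fun s ℓ => P s ℓ ω) t) (held τ (fun s ℓ => Q s ℓ ω) t) := by
  intro ℓ
  obtain ⟨s, -, hs⟩ := exists_held_eq (∀ ℓ, Matrix (Fin (m ℓ)) (Fin (r ℓ)) ℝ) τ t
  obtain ⟨s', -, hs'⟩ := exists_held_eq (∀ ℓ, Matrix (Fin (n ℓ)) (Fin (r ℓ)) ℝ) τ t
  rw [hs, hs']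
  exact ⟨(hω s ℓ).1, (hω s' ℓ).2⟩

lemma momentumAt_zero : momentumAt F β η τ x₀ ξ P Q 0 ω = 0 :=
  block_ext fun ℓ => by
    by_cases hℓ : m ℓ ≤ n ℓ <;> simp [momentumAt, block_fullMomentum, run, hℓ] <;> rfl

lemma iterate_succ (t : ℕ) : iterate F β η τ x₀ ξ P Q (t + 1) ω
    = iterate F β η τ x₀ ξ P Q t ω - η • momentumAt F β η τ x₀ ξ P Q (t + 1) ω :=
  step_x β η τ t _ _

lemma momentumAt_succ
    (hω : ∀ t, OrthonormalColumns (fun ℓ => P t ℓ ω) (fun ℓ => Q t ℓ ω)) (t : ℕ) :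
    momentumAt F β η τ x₀ ξ P Q (t + 1) ω = projAt τ P Q t ω
      ((1 - β) • momentumAt F β η τ x₀ ξ P Q t ω
        + β • stochGrad F (iterate F β η τ x₀ ξ P Q t ω) (ξ t ω)) := by
  by_cases ht : τ ∣ t
  · exact fullMomentum_step_of_dvd β η ht _ _
  · have hstep := (orthonormalColumns_held (τ := τ) hω t).fullMomentum_step_of_not_dvd
      (P' := held τ (fun s ℓ => P s ℓ ω) (t - 1)) (Q' := held τ (fun s ℓ => Q s ℓ ω) (t - 1))
      β η ht (stochGrad F (iterate F β η τ x₀ ξ P Q t ω) (ξ t ω))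
      (run F β η τ x₀ (fun s => ξ s ω) (fun s ℓ => P s ℓ ω) (fun s ℓ => Q s ℓ ω) t)
    rw [momentumAt, momentumAt, projAt, ← held_of_not_dvd _ ht, ← held_of_not_dvd _ ht]
    exact hstep

end Run

section MeasurableRun

variable {N : ℕ} {m n r : Fin N → ℕ} {Ω Ξ : Type*} [MeasurableSpace Ω] [MeasurableSpace Ξ]
  {F : Params m n → Ξ → ℝ} {ξ : ℕ → Ω → Ξ}
  {P : ℕ → ∀ ℓ, Ω → Matrix (Fin (m ℓ)) (Fin (r ℓ)) ℝ}
  {Q : ℕ → ∀ ℓ, Ω → Matrix (Fin (n ℓ)) (Fin (r ℓ)) ℝ} {t : ℕ}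

lemma measurable_projAt (τ : ℕ) (hP : ∀ s ≤ t, ∀ ℓ, Measurable (P s ℓ))
    (hQ : ∀ s ≤ t, ∀ ℓ, Measurable (Q s ℓ)) {w : Ω → Params m n} (hw : Measurable w) :
    Measurable fun ω => projAt τ P Q t ω (w ω) :=
  measurable_blockProj (measurable_held hP) (measurable_held hQ) hw

variable (hF : Measurable fun p : Params m n × Ξ => stochGrad F p.1 p.2) (β η : ℝ) (τ : ℕ)
  (x₀ : Params m n)
include hF

lemma measurable_iterate (hξ : ∀ s < t, Measurable (ξ s))
    (hP : ∀ s < t, ∀ ℓ, Measurable (P s ℓ)) (hQ : ∀ s < t, ∀ ℓ, Measurable (Q s ℓ)) :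
    Measurable (iterate F β η τ x₀ ξ P Q t) :=
  (measurableState_run hF β η τ x₀ hξ hP hQ).x

lemma measurable_momentumAt (hξ : ∀ s < t, Measurable (ξ s))
    (hP : ∀ s ≤ t, ∀ ℓ, Measurable (P s ℓ)) (hQ : ∀ s ≤ t, ∀ ℓ, Measurable (Q s ℓ)) :
    Measurable (momentumAt F β η τ x₀ ξ P Q t) :=
  have hs := measurableState_run hF β η τ x₀ hξ (fun s hs => hP s hs.le) fun s hs => hQ s hs.le
  measurable_fullMomentum (measurable_held fun s hs => hP s (by lia))
    (measurable_held fun s hs => hQ s (by lia)) hs.left hs.right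

end MeasurableRun

/-! ### Independence of the past and the next draw -/

section History

variable {N : ℕ} {m n r : Fin N → ℕ} {Ω Ξ : Type*} [MeasurableSpace Ξ]

/-- The pair of projection matrices sampled at time `i.1` for layer `i.2`. -/
def projPair (P : ℕ → ∀ ℓ, Ω → Matrix (Fin (m ℓ)) (Fin (r ℓ)) ℝ)
    (Q : ℕ → ∀ ℓ, Ω → Matrix (Fin (n ℓ)) (Fin (r ℓ)) ℝ) (i : ℕ × Fin N) (ω : Ω) :
    Matrix (Fin (m i.2)) (Fin (r i.2)) ℝ × Matrix (Fin (n i.2)) (Fin (r i.2)) ℝ :=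
  (P i.1 i.2 ω, Q i.1 i.2 ω)

/-- All that is independent of the data point drawn at time `t`, as far as the run up to that time
is concerned: the data points before time `t` and all projections. -/
def dataHistory (ξ : ℕ → Ω → Ξ) (P : ℕ → ∀ ℓ, Ω → Matrix (Fin (m ℓ)) (Fin (r ℓ)) ℝ)
    (Q : ℕ → ∀ ℓ, Ω → Matrix (Fin (n ℓ)) (Fin (r ℓ)) ℝ) (t : ℕ) (ω : Ω) :
    (Finset.range t → Ξ) × (∀ i : ℕ × Fin N, Matrix (Fin (m i.2)) (Fin (r i.2)) ℝ ×
      Matrix (Fin (n i.2)) (Fin (r i.2)) ℝ) :=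
  (fun s => ξ s ω, fun i => projPair P Q i ω)

/-- All that is independent of the projections drawn at time `t`, as far as the run up to that time
is concerned: the projections before time `t` and all data points. -/
def projHistory (ξ : ℕ → Ω → Ξ) (P : ℕ → ∀ ℓ, Ω → Matrix (Fin (m ℓ)) (Fin (r ℓ)) ℝ)
    (Q : ℕ → ∀ ℓ, Ω → Matrix (Fin (n ℓ)) (Fin (r ℓ)) ℝ) (t : ℕ) (ω : Ω) :
    (∀ i : (Finset.range t ×ˢ Finset.univ : Finset (ℕ × Fin N)),
      Matrix (Fin (m i.1.2)) (Fin (r i.1.2)) ℝ × Matrix (Fin (n i.1.2)) (Fin (r i.1.2)) ℝ)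
      × (ℕ → Ξ) :=
  (fun i => projPair P Q i ω, fun s => ξ s ω)

variable {ξ : ℕ → Ω → Ξ} {P : ℕ → ∀ ℓ, Ω → Matrix (Fin (m ℓ)) (Fin (r ℓ)) ℝ}
  {Q : ℕ → ∀ ℓ, Ω → Matrix (Fin (n ℓ)) (Fin (r ℓ)) ℝ}

lemma measurable_data_dataHistory {s t : ℕ} (hs : s < t) :
    Measurable[MeasurableSpace.comap (dataHistory ξ P Q t) inferInstance] (ξ s) :=
  (measurable_pi_apply (⟨s, Finset.mem_range.2 hs⟩ : Finset.range t)).comp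
    (measurable_fst.comp (comap_measurable (dataHistory ξ P Q t)))

lemma measurable_projPair_dataHistory (t : ℕ) (i : ℕ × Fin N) :
    Measurable[MeasurableSpace.comap (dataHistory ξ P Q t) inferInstance] (projPair P Q i) :=
  (measurable_pi_apply i).comp (measurable_snd.comp (comap_measurable (dataHistory ξ P Q t)))

lemma measurable_data_projHistory (t s : ℕ) :
    Measurable[MeasurableSpace.comap (projHistory ξ P Q t) inferInstance] (ξ s) :=
  (measurable_pi_apply s).comp (measurable_snd.comp (comap_measurable (projHistory ξ P Q t)))

lemma measurable_projPair_projHistory {t : ℕ} {i : ℕ × Fin N} (hi : i.1 < t) :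
    Measurable[MeasurableSpace.comap (projHistory ξ P Q t) inferInstance] (projPair P Q i) :=
  (measurable_pi_apply (⟨i, by simp [hi]⟩ :
    (Finset.range t ×ˢ Finset.univ : Finset (ℕ × Fin N)))).comp
    (measurable_fst.comp (comap_measurable (projHistory ξ P Q t)))

variable [MeasurableSpace Ω] {μ : Measure Ω} {D : Measure Ξ} {F : Params m n → Ξ → ℝ}

namespace Sampling

variable (hS : Sampling μ D ξ P Q)
include hS

lemma measurable_projPair (i : ℕ × Fin N) : Measurable (projPair P Q i) :=
  (hS.measurable_left i.1 i.2).prodMk (hS.measurable_right i.1 i.2)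

lemma measurable_iterate (hF : Measurable fun p : Params m n × Ξ => stochGrad F p.1 p.2)
    (β η : ℝ) (τ : ℕ) (x₀ : Params m n) (t : ℕ) : Measurable (iterate F β η τ x₀ ξ P Q t) :=
  GoLore.measurable_iterate hF β η τ x₀ (fun s _ => hS.measurable_data s)
    (fun s _ => hS.measurable_left s) (fun s _ => hS.measurable_right s)

lemma measurable_momentumAt (hF : Measurable fun p : Params m n × Ξ => stochGrad F p.1 p.2)
    (β η : ℝ) (τ : ℕ) (x₀ : Params m n) (t : ℕ) : Measurable (momentumAt F β η τ x₀ ξ P Q t) :=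
  GoLore.measurable_momentumAt hF β η τ x₀ (fun s _ => hS.measurable_data s)
    (fun s _ => hS.measurable_left s) (fun s _ => hS.measurable_right s)

lemma measurable_projAt (τ t : ℕ) {w : Ω → Params m n} (hw : Measurable w) :
    Measurable fun ω => projAt τ P Q t ω (w ω) :=
  GoLore.measurable_projAt τ (fun s _ => hS.measurable_left s) (fun s _ => hS.measurable_right s)
    hw

lemma ae_orthonormalColumns (hr : ∀ ℓ, r ℓ ≤ m ℓ ∧ r ℓ ≤ n ℓ) :
    ∀ᵐ ω ∂μ, ∀ t, OrthonormalColumns (fun ℓ => P t ℓ ω) (fun ℓ => Q t ℓ ω) := by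
  simp only [OrthonormalColumns, ae_all_iff]
  intro t ℓ
  have hP := ae_stiefelUniform_transpose_mul_self (hr ℓ).1
  have hQ := ae_stiefelUniform_transpose_mul_self (hr ℓ).2
  rw [← hS.law_left t ℓ] at hP
  rw [← hS.law_right t ℓ] at hQ
  exact (ae_of_ae_map (hS.measurable_left t ℓ).aemeasurable hP).and
    (ae_of_ae_map (hS.measurable_right t ℓ).aemeasurable hQ)

variable [IsFiniteMeasure μ]

lemma indepFun_dataHistory (t : ℕ) : IndepFun (ξ t) (dataHistory ξ P Q t) μ := by
  refine indepFun_prodMk_right (hS.measurable_data t)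
    (measurable_pi_iff.2 fun s => hS.measurable_data s)
    (measurable_pi_iff.2 fun i => hS.measurable_projPair i) ?_ ?_ ?_
  · exact (hS.indep_data.indepFun_finset {t} (Finset.range t) (by simp) hS.measurable_data).comp
      (measurable_pi_apply ⟨t, Finset.mem_singleton_self t⟩) measurable_id
  · exact hS.indep_data_proj.comp (φ := fun z : ℕ → Ξ => fun s : Finset.range t => z s)
      (by fun_prop) measurable_id
  · exact hS.indep_data_proj.comp (φ := fun z : ℕ → Ξ => (z t, fun s : Finset.range t => z s))
      (by fun_prop) measurable_id

lemma indepFun_projHistory (i : ℕ × Fin N) :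
    IndepFun (projPair P Q i) (projHistory ξ P Q i.1) μ := by
  refine indepFun_prodMk_right (hS.measurable_projPair i)
    (measurable_pi_iff.2 fun i => hS.measurable_projPair i)
    (measurable_pi_iff.2 fun s => hS.measurable_data s) ?_ ?_ ?_
  · exact (hS.indep_proj.indepFun_finset {i} (Finset.range i.1 ×ˢ Finset.univ) (by simp)
      hS.measurable_projPair).comp (measurable_pi_apply ⟨i, Finset.mem_singleton_self i⟩)
      measurable_id
  · exact hS.indep_data_proj.symm.comp
      (φ := fun z (j : (Finset.range i.1 ×ˢ Finset.univ : Finset (ℕ × Fin N))) => z j)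
      (by fun_prop) measurable_id
  · exact hS.indep_data_proj.symm.comp
      (φ := fun z => (z i,
        fun j : (Finset.range i.1 ×ˢ Finset.univ : Finset (ℕ × Fin N)) => z j))
      (by fun_prop) measurable_id

variable (hF : Measurable fun p : Params m n × Ξ => stochGrad F p.1 p.2)
include hF

lemma indepFun_projAt_iterate_data (β η : ℝ) (τ : ℕ) (x₀ : Params m n)
    {g : Params m n → Params m n} (hg : Measurable g) (t : ℕ) :
    IndepFun (fun ω => (projAt τ P Q t ω (momentumAt F β η τ x₀ ξ P Q t ω
      - g (iterate F β η τ x₀ ξ P Q t ω)), iterate F β η τ x₀ ξ P Q t ω)) (ξ t) μ := by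
  refine (indepFun_of_measurable_comap (hS.indepFun_dataHistory t) ?_).symm
  let _ : MeasurableSpace Ω := MeasurableSpace.comap (dataHistory ξ P Q t) inferInstance
  have hξ : ∀ s < t, Measurable (ξ s) := fun s hs => measurable_data_dataHistory hs
  have hP : ∀ s ℓ, Measurable (P s ℓ) := fun s ℓ =>
    measurable_fst.comp (measurable_projPair_dataHistory t (s, ℓ))
  have hQ : ∀ s ℓ, Measurable (Q s ℓ) := fun s ℓ =>
    measurable_snd.comp (measurable_projPair_dataHistory t (s, ℓ))
  have hx := GoLore.measurable_iterate hF β η τ x₀ hξ (fun s _ => hP s) (fun s _ => hQ s)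
  have hM := GoLore.measurable_momentumAt hF β η τ x₀ hξ (fun s _ => hP s) (fun s _ => hQ s)
  exact (GoLore.measurable_projAt τ (fun s _ => hP s) (fun s _ => hQ s)
    (hM.sub (hg.comp hx))).prodMk hx

lemma indepFun_iterate_projPair (β η : ℝ) (τ : ℕ) (x₀ : Params m n) (i : ℕ × Fin N) :
    IndepFun (iterate F β η τ x₀ ξ P Q i.1) (projPair P Q i) μ := by
  refine (indepFun_of_measurable_comap (hS.indepFun_projHistory i) ?_).symm
  let _ : MeasurableSpace Ω := MeasurableSpace.comap (projHistory ξ P Q i.1) inferInstance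
  exact GoLore.measurable_iterate hF β η τ x₀ (fun s _ => measurable_data_projHistory i.1 s)
    (fun s hs ℓ => measurable_fst.comp (measurable_projPair_projHistory (i := (s, ℓ)) hs))
    (fun s hs ℓ => measurable_snd.comp (measurable_projPair_projHistory (i := (s, ℓ)) hs))

end Sampling

end History

/-! ### The noise of the stochastic gradient -/

section Noise

variable {N : ℕ} {m n : Fin N → ℕ} {Ξ : Type*} [MeasurableSpace Ξ] {F : Params m n → Ξ → ℝ}
  {D : Measure Ξ} {σ : Fin N → ℝ}

/-- The error of the stochastic gradient at `x` and the data point `y`. -/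
noncomputable def gradNoise (F : Params m n → Ξ → ℝ) (D : Measure Ξ) (x : Params m n) (y : Ξ) :
    Params m n :=
  stochGrad F x y - gradient (objective F D) x

lemma norm_gradNoise_sq (x : Params m n) (y : Ξ) : ‖gradNoise F D x y‖ ^ 2
    = ∑ ℓ, frobSq (block (stochGrad F x y) ℓ - block (gradient (objective F D) x) ℓ) := by
  simp only [norm_sq_eq_sum_frobSq, gradNoise, block_sub]

namespace StochasticGradient

variable (hG : StochasticGradient F D σ)
include hG

lemma measurable_gradNoise (hg : Measurable (gradient (objective F D))) :
    Measurable fun p : Params m n × Ξ => gradNoise F D p.1 p.2 :=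
  hG.measurable_grad.sub (hg.comp measurable_fst)

lemma integrable_norm_gradNoise_sq (x : Params m n) :
    Integrable (fun y => ‖gradNoise F D x y‖ ^ 2) D := by
  simp only [norm_gradNoise_sq]
  exact integrable_finsetSum _ fun ℓ _ => hG.integrable_sq x ℓ

lemma integral_norm_gradNoise_sq_le (x : Params m n) :
    ∫ y, ‖gradNoise F D x y‖ ^ 2 ∂D ≤ totalSigma σ ^ 2 := by
  rw [totalSigma, Real.sq_sqrt (Finset.sum_nonneg fun ℓ _ => sq_nonneg _)]
  simp only [norm_gradNoise_sq]
  rw [integral_finsetSum _ fun ℓ _ => hG.integrable_sq x ℓ]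
  exact Finset.sum_le_sum fun ℓ _ => hG.variance_le x ℓ

variable [IsProbabilityMeasure D]

lemma integrable_gradNoise (x : Params m n) : Integrable (gradNoise F D x) D :=
  (hG.integrable_grad x).sub (integrable_const _)

lemma integral_gradNoise (x : Params m n) : ∫ y, gradNoise F D x y ∂D = 0 := by
  simp only [gradNoise]
  rw [integral_sub (hG.integrable_grad x) (integrable_const _), hG.unbiased, integral_const,
    probReal_univ, one_smul, sub_self]

lemma integral_inner_gradNoise (w x : Params m n) :
    ∫ y, inner ℝ w (gradNoise F D x y) ∂D = 0 := by
  rw [integral_inner (hG.integrable_gradNoise x), hG.integral_gradNoise, inner_zero_right]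

end StochasticGradient

end Noise

section NoiseAlongRun

variable {N : ℕ} {m n : Fin N → ℕ} {Ω Ξ : Type*} [MeasurableSpace Ω] [MeasurableSpace Ξ]
  {μ : Measure Ω} {F : Params m n → Ξ → ℝ} {σ : Fin N → ℝ} {W X : Ω → Params m n} {Y : Ω → Ξ}

lemma measurable_gradNoise_comp {D : Measure Ξ} (hG : StochasticGradient F D σ)
    (hg : Measurable (gradient (objective F D))) (hX : Measurable X) (hY : Measurable Y) :
    Measurable fun ω => gradNoise F D (X ω) (Y ω) := by
  have hcomp := (hG.measurable_gradNoise hg).comp (hX.prodMk hY)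
  exact hcomp

variable (hG : StochasticGradient F (μ.map Y) σ)
  (hg : Measurable (gradient (objective F (μ.map Y)))) (hX : Measurable X) (hY : Measurable Y)
include hG hg hX hY

lemma memLp_gradNoise_of_indepFun [IsFiniteMeasure μ] (hXY : IndepFun X Y μ) :
    MemLp (fun ω => gradNoise F (μ.map Y) (X ω) (Y ω)) 2 μ :=
  (memLp_two_iff_integrable_sq_norm
    (measurable_gradNoise_comp hG hg hX hY).aestronglyMeasurable).2 <|
    integrable_comp_of_indepFun hX hY hXY ((hG.measurable_gradNoise hg).norm.pow_const 2)
      (fun _ => sq_nonneg _) hG.integrable_norm_gradNoise_sq hG.integral_norm_gradNoise_sq_le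

variable [IsProbabilityMeasure μ]

lemma integral_norm_gradNoise_sq_le_of_indepFun (hXY : IndepFun X Y μ) :
    ∫ ω, ‖gradNoise F (μ.map Y) (X ω) (Y ω)‖ ^ 2 ∂μ ≤ totalSigma σ ^ 2 :=
  integral_comp_le_of_indepFun hX hY hXY ((hG.measurable_gradNoise hg).norm.pow_const 2)
    (fun _ => sq_nonneg _) hG.integrable_norm_gradNoise_sq hG.integral_norm_gradNoise_sq_le

lemma integral_inner_gradNoise_of_indepFun (hW : Measurable W)
    (hWXY : IndepFun (fun ω => (W ω, X ω)) Y μ)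
    (hint : Integrable (fun ω => inner ℝ (W ω) (gradNoise F (μ.map Y) (X ω) (Y ω))) μ) :
    ∫ ω, inner ℝ (W ω) (gradNoise F (μ.map Y) (X ω) (Y ω)) ∂μ = 0 := by
  have := Measure.isProbabilityMeasure_map (μ := μ) hY.aemeasurable
  have hm : Measurable fun p : (Params m n × Params m n) × Ξ =>
      inner ℝ p.1.1 (gradNoise F (μ.map Y) p.1.2 p.2) :=
    (measurable_fst.comp measurable_fst).inner
      (measurable_gradNoise_comp hG hg (measurable_snd.comp measurable_fst) measurable_snd)
  rw [integral_comp_of_indepFun (hW.prodMk hX) hY hWXY hm hint]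
  simp only [hG.integral_inner_gradNoise, integral_zero]

end NoiseAlongRun

/-! ### The energy kept by the projections -/

section MinDelta

variable {N : ℕ} {m n r : Fin N → ℕ}

lemma minDelta_le (ℓ : Fin N) : minDelta m n r ≤ (r ℓ : ℝ) / (min (m ℓ) (n ℓ) : ℕ) :=
  ciInf_le (Set.finite_range _).bddBelow ℓ

lemma minDelta_pos [Nonempty (Fin N)] (hr : ∀ ℓ, 1 ≤ r ℓ ∧ r ℓ ≤ m ℓ ∧ r ℓ ≤ n ℓ) :
    0 < minDelta m n r := by
  obtain ⟨ℓ, hℓ⟩ := exists_eq_ciInf_of_finite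
    (f := fun ℓ : Fin N => (r ℓ : ℝ) / (min (m ℓ) (n ℓ) : ℕ))
  rw [minDelta, ← hℓ]
  obtain ⟨hr, hm, hn⟩ := hr ℓ
  exact div_pos (Nat.cast_pos.2 hr) (Nat.cast_pos.2 (lt_min (hr.trans hm) (hr.trans hn)))

lemma minDelta_le_one [Nonempty (Fin N)] (hr : ∀ ℓ, r ℓ ≤ m ℓ ∧ r ℓ ≤ n ℓ) :
    minDelta m n r ≤ 1 := by
  obtain ⟨ℓ⟩ := ‹Nonempty (Fin N)›
  exact (minDelta_le ℓ).trans
    (div_le_one_of_le₀ (Nat.cast_le.2 (le_min (hr ℓ).1 (hr ℓ).2)) (Nat.cast_nonneg _))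

end MinDelta

section Energy

variable {Ω : Type*} [MeasurableSpace Ω] {μ : Measure Ω}

lemma integral_frobSq_of_indepFun [IsFiniteMeasure μ] {a b c : ℕ} (hba : b ≤ a)
    {B : Ω → Matrix (Fin a) (Fin c) ℝ} {S : Ω → Matrix (Fin a) (Fin b) ℝ} (hB : Measurable B)
    (hS : Measurable S) (hlaw : μ.map S = stiefelUniform a b) (hBS : IndepFun B S μ)
    (hint : Integrable (fun ω => frobSq (S ω * (S ω)ᵀ * B ω)) μ) :
    ∫ ω, frobSq (S ω * (S ω)ᵀ * B ω) ∂μ = b / a * ∫ ω, frobSq (B ω) ∂μ := by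
  have hm : Measurable fun p : Matrix (Fin a) (Fin c) ℝ × Matrix (Fin a) (Fin b) ℝ =>
      frobSq (p.2 * p.2ᵀ * p.1) :=
    (continuous_frobSq.comp (by fun_prop)).measurable
  rw [integral_comp_of_indepFun hB hS hBS hm hint, hlaw, ← integral_const_mul]
  simp only [integral_frobSq_stiefelUniform hba]

variable {N : ℕ} {m n r : Fin N → ℕ}

lemma frobSq_block_le (x : Params m n) (ℓ : Fin N) : frobSq (block x ℓ) ≤ ‖x‖ ^ 2 := by
  rw [norm_sq_eq_sum_frobSq]
  exact Finset.single_le_sum (f := fun ℓ => frobSq (block x ℓ)) (fun _ _ => frobSq_nonneg _)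
    (Finset.mem_univ ℓ)

lemma integrable_frobSq_block {v : Ω → Params m n} (hv : MemLp v 2 μ) (ℓ : Fin N) :
    Integrable (fun ω => frobSq (block (v ω) ℓ)) μ :=
  (integrable_norm_sq_of_memLp_two hv).mono'
    ((continuous_frobSq.comp (continuous_block ℓ)).comp_aestronglyMeasurable hv.1)
    (.of_forall fun ω => by
      rw [Real.norm_of_nonneg (frobSq_nonneg _)]
      exact frobSq_block_le _ ℓ)

lemma integral_norm_sq_eq_sum {v : Ω → Params m n} (hv : MemLp v 2 μ) :
    ∫ ω, ‖v ω‖ ^ 2 ∂μ = ∑ ℓ, ∫ ω, frobSq (block (v ω) ℓ) ∂μ := by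
  simp only [norm_sq_eq_sum_frobSq]
  exact integral_finsetSum _ fun ℓ _ => integrable_frobSq_block hv ℓ

variable [IsFiniteMeasure μ] {P : ∀ ℓ, Ω → Matrix (Fin (m ℓ)) (Fin (r ℓ)) ℝ}
  {Q : ∀ ℓ, Ω → Matrix (Fin (n ℓ)) (Fin (r ℓ)) ℝ} {v : Ω → Params m n}

lemma integral_frobSq_block_blockProj {ℓ : Fin N} (hr : r ℓ ≤ m ℓ ∧ r ℓ ≤ n ℓ)
    (hP : Measurable (P ℓ)) (hQ : Measurable (Q ℓ))
    (hPlaw : μ.map (P ℓ) = stiefelUniform (m ℓ) (r ℓ))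
    (hQlaw : μ.map (Q ℓ) = stiefelUniform (n ℓ) (r ℓ)) (hv : Measurable v)
    (hind : IndepFun v (fun ω => (P ℓ ω, Q ℓ ω)) μ) (hint : Integrable (fun ω =>
      frobSq (block (blockProj (fun ℓ => P ℓ ω) (fun ℓ => Q ℓ ω) (v ω)) ℓ)) μ) :
    ∫ ω, frobSq (block (blockProj (fun ℓ => P ℓ ω) (fun ℓ => Q ℓ ω) (v ω)) ℓ) ∂μ
      = (r ℓ : ℝ) / (min (m ℓ) (n ℓ) : ℕ) * ∫ ω, frobSq (block (v ω) ℓ) ∂μ := by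
  have hblock := (continuous_block (m := m) (n := n) ℓ).measurable
  by_cases hℓ : m ℓ ≤ n ℓ
  · simp only [block_blockProj, hℓ, if_true] at hint ⊢
    rw [min_eq_left hℓ]
    exact integral_frobSq_of_indepFun hr.1 (measurable_block hv ℓ) hP hPlaw
      (hind.comp hblock measurable_fst) hint
  · have htranspose : ∀ ω, frobSq (block (v ω) ℓ * (Q ℓ ω * (Q ℓ ω)ᵀ))
        = frobSq (Q ℓ ω * (Q ℓ ω)ᵀ * (block (v ω) ℓ)ᵀ) := fun ω => by
      rw [← frobSq_transpose, Matrix.transpose_mul, Matrix.transpose_mul,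
        Matrix.transpose_transpose]
    simp only [block_blockProj, hℓ, if_false, htranspose] at hint ⊢
    rw [min_eq_right (not_le.1 hℓ).le, integral_frobSq_of_indepFun hr.2
      (measurable_matrix_transpose (measurable_block hv ℓ)) hQ hQlaw
      (hind.comp (measurable_matrix_transpose hblock) measurable_snd) hint]
    simp only [frobSq_transpose]

lemma minDelta_mul_integral_norm_sq_le (hr : ∀ ℓ, r ℓ ≤ m ℓ ∧ r ℓ ≤ n ℓ)
    (hP : ∀ ℓ, Measurable (P ℓ)) (hQ : ∀ ℓ, Measurable (Q ℓ))
    (hPlaw : ∀ ℓ, μ.map (P ℓ) = stiefelUniform (m ℓ) (r ℓ))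
    (hQlaw : ∀ ℓ, μ.map (Q ℓ) = stiefelUniform (n ℓ) (r ℓ)) (hv : Measurable v)
    (hind : ∀ ℓ, IndepFun v (fun ω => (P ℓ ω, Q ℓ ω)) μ) (hvL : MemLp v 2 μ)
    (hpv : MemLp (fun ω => blockProj (fun ℓ => P ℓ ω) (fun ℓ => Q ℓ ω) (v ω)) 2 μ) :
    minDelta m n r * ∫ ω, ‖v ω‖ ^ 2 ∂μ
      ≤ ∫ ω, ‖blockProj (fun ℓ => P ℓ ω) (fun ℓ => Q ℓ ω) (v ω)‖ ^ 2 ∂μ := by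
  rw [integral_norm_sq_eq_sum hvL, integral_norm_sq_eq_sum hpv, Finset.mul_sum]
  refine Finset.sum_le_sum fun ℓ _ => ?_
  rw [integral_frobSq_block_blockProj (hr ℓ) (hP ℓ) (hQ ℓ) (hPlaw ℓ) (hQlaw ℓ) hv (hind ℓ)
    (integrable_frobSq_block hpv ℓ)]
  exact mul_le_mul_of_nonneg_right (minDelta_le ℓ) (integral_nonneg fun _ => frobSq_nonneg _)

end Energy

/-! ### GoLore as projected momentum -/

section GoLoreRun

variable {N : ℕ} {m n r : Fin N → ℕ} {Ω Ξ : Type*} [MeasurableSpace Ω] [MeasurableSpace Ξ]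
  {μ : Measure Ω} {D : Measure Ξ} {F : Params m n → Ξ → ℝ} {L : ℝ} {σ : Fin N → ℝ}
  {ξ : ℕ → Ω → Ξ} {P : ℕ → ∀ ℓ, Ω → Matrix (Fin (m ℓ)) (Fin (r ℓ)) ℝ}
  {Q : ℕ → ∀ ℓ, Ω → Matrix (Fin (n ℓ)) (Fin (r ℓ)) ℝ}

/-- The stochastic gradient error at time `t` of the run. -/
noncomputable def noiseAt (F : Params m n → Ξ → ℝ) (D : Measure Ξ) (β η : ℝ) (τ : ℕ)
    (x₀ : Params m n) (ξ : ℕ → Ω → Ξ) (P : ℕ → ∀ ℓ, Ω → Matrix (Fin (m ℓ)) (Fin (r ℓ)) ℝ)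
    (Q : ℕ → ∀ ℓ, Ω → Matrix (Fin (n ℓ)) (Fin (r ℓ)) ℝ) (t : ℕ) (ω : Ω) : Params m n :=
  gradNoise F D (iterate F β η τ x₀ ξ P Q t ω) (ξ t ω)

namespace Sampling

variable [IsProbabilityMeasure μ] (hS : Sampling μ D ξ P Q) (hG : StochasticGradient F D σ)
  (hg : Measurable (gradient (objective F D))) (β η : ℝ) (τ : ℕ) (x₀ : Params m n)
include hS hG hg

lemma indepFun_iterate_data (t : ℕ) : IndepFun (iterate F β η τ x₀ ξ P Q t) (ξ t) μ :=
  (hS.indepFun_projAt_iterate_data hG.measurable_grad β η τ x₀ hg t).comp measurable_snd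
    measurable_id

lemma memLp_noiseAt (t : ℕ) : MemLp (noiseAt F D β η τ x₀ ξ P Q t) 2 μ := by
  have hind := hS.indepFun_iterate_data hG hg β η τ x₀ t
  obtain rfl := hS.law_data t
  exact memLp_gradNoise_of_indepFun hG hg (hS.measurable_iterate hG.measurable_grad β η τ x₀ t)
    (hS.measurable_data t) hind

lemma integral_norm_noiseAt_sq_le (t : ℕ) :
    ∫ ω, ‖noiseAt F D β η τ x₀ ξ P Q t ω‖ ^ 2 ∂μ ≤ totalSigma σ ^ 2 := by
  have hind := hS.indepFun_iterate_data hG hg β η τ x₀ t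
  obtain rfl := hS.law_data t
  exact integral_norm_gradNoise_sq_le_of_indepFun hG hg
    (hS.measurable_iterate hG.measurable_grad β η τ x₀ t) (hS.measurable_data t) hind

lemma integral_inner_projAt_noiseAt (t : ℕ)
    (hw : MemLp (fun ω => projAt τ P Q t ω (momentumAt F β η τ x₀ ξ P Q t ω
      - gradient (objective F D) (iterate F β η τ x₀ ξ P Q t ω))) 2 μ) :
    ∫ ω, inner ℝ (projAt τ P Q t ω (momentumAt F β η τ x₀ ξ P Q t ω
      - gradient (objective F D) (iterate F β η τ x₀ ξ P Q t ω)))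
      (noiseAt F D β η τ x₀ ξ P Q t ω) ∂μ = 0 := by
  have hx := hS.measurable_iterate hG.measurable_grad β η τ x₀ t
  have hM := hS.measurable_momentumAt hG.measurable_grad β η τ x₀ t
  have hind := hS.indepFun_projAt_iterate_data hG.measurable_grad β η τ x₀ hg t
  have hint := integrable_inner_of_memLp_two hw (hS.memLp_noiseAt hG hg β η τ x₀ t)
  obtain rfl := hS.law_data t
  exact integral_inner_gradNoise_of_indepFun hG hg hx (hS.measurable_data t)
    (hS.measurable_projAt τ t (hM.sub (hg.comp hx))) hind hint

lemma minDelta_mul_integral_gradient_sq_le (hr : ∀ ℓ, r ℓ ≤ m ℓ ∧ r ℓ ≤ n ℓ) {t : ℕ} (ht : τ ∣ t)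
    (hgL : MemLp (fun ω => gradient (objective F D) (iterate F β η τ x₀ ξ P Q t ω)) 2 μ) :
    minDelta m n r * ∫ ω, ‖gradient (objective F D) (iterate F β η τ x₀ ξ P Q t ω)‖ ^ 2 ∂μ
      ≤ ∫ ω, ‖projAt τ P Q t ω
          (gradient (objective F D) (iterate F β η τ x₀ ξ P Q t ω))‖ ^ 2 ∂μ := by
  have hgx := hg.comp (hS.measurable_iterate hG.measurable_grad β η τ x₀ t)
  have hpL : MemLp (fun ω => projAt τ P Q t ω
      (gradient (objective F D) (iterate F β η τ x₀ ξ P Q t ω))) 2 μ :=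
    hgL.of_le (hS.measurable_projAt τ t hgx).aestronglyMeasurable <|
      (hS.ae_orthonormalColumns hr).mono fun ω hω => norm_apply_le_of_isSymmetricProjection
        (orthonormalColumns_held hω t).isSymmetricProjection_blockProj _
  simp only [projAt_of_dvd ht] at hpL ⊢
  exact minDelta_mul_integral_norm_sq_le hr (hS.measurable_left t) (hS.measurable_right t)
    (hS.law_left t) (hS.law_right t) hgx
    (fun ℓ => (hS.indepFun_iterate_projPair hG.measurable_grad β η τ x₀ (t, ℓ)).comp hg
      measurable_id) hgL hpL

omit hg in
theorem projectedMomentum (hr : ∀ ℓ, r ℓ ≤ m ℓ ∧ r ℓ ≤ n ℓ)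
    (hbdd : BddBelow (Set.range (objective F D))) (hL : LSmooth (objective F D) L) :
    ProjectedMomentum μ (objective F D) L (minDelta m n r) β η (totalSigma σ) τ x₀
      (iterate F β η τ x₀ ξ P Q) (momentumAt F β η τ x₀ ξ P Q) (noiseAt F D β η τ x₀ ξ P Q)
      (projAt τ P Q) := by
  have hg := (continuous_gradient_of_lipschitz hL.2).measurable
  have horth := hS.ae_orthonormalColumns hr
  exact
    { differentiable := hL.1
      lipschitz := hL.2
      bddBelow := hbdd
      measurable_x := hS.measurable_iterate hG.measurable_grad β η τ x₀
      measurable_M := hS.measurable_momentumAt hG.measurable_grad β η τ x₀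
      measurable_A := fun t w hw => hS.measurable_projAt τ t hw
      proj := horth.mono fun ω hω t =>
        (orthonormalColumns_held hω t).isSymmetricProjection_blockProj
      held := fun t ω ht => projAt_add_one_of_not_dvd ht
      x_zero := fun _ => rfl
      x_succ := fun t ω => iterate_succ F β η x₀ ξ t
      M_zero := fun ω => momentumAt_zero F β η x₀ ξ
      M_succ := horth.mono fun ω hω t => by
        rw [momentumAt_succ F β η x₀ ξ hω t, noiseAt, gradNoise, add_sub_cancel]
      memLp_noise := hS.memLp_noiseAt hG hg β η τ x₀
      noise_sq_le := hS.integral_norm_noiseAt_sq_le hG hg β η τ x₀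
      noise_orthogonal := hS.integral_inner_projAt_noiseAt hG hg β η τ x₀
      energy_le := fun k =>
        hS.minDelta_mul_integral_gradient_sq_le hG hg β η τ x₀ hr (dvd_mul_left τ k) }

end Sampling

end GoLoreRun

/-! ### The hyperparameters for a given horizon -/

section HalfIntegerPowers

variable {δ : ℝ}

lemma rpow_half_eq_sqrt_pow (hδ : 0 ≤ δ) (k : ℕ) : δ ^ ((k : ℝ) / 2) = √δ ^ k := by
  rw [Real.rpow_div_two_eq_sqrt _ hδ, Real.rpow_natCast]

lemma rpow_three_half (hδ : 0 ≤ δ) : δ ^ (3 / 2 : ℝ) = √δ ^ 3 := by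
  exact_mod_cast rpow_half_eq_sqrt_pow hδ 3

lemma rpow_five_half (hδ : 0 ≤ δ) : δ ^ (5 / 2 : ℝ) = √δ ^ 5 := by
  exact_mod_cast rpow_half_eq_sqrt_pow hδ 5

lemma rpow_seven_half (hδ : 0 ≤ δ) : δ ^ (7 / 2 : ℝ) = √δ ^ 7 := by
  exact_mod_cast rpow_half_eq_sqrt_pow hδ 7

end HalfIntegerPowers

section Admissibility

variable (δ s L Δ : ℝ) (T : ℕ)

lemma betaT_pos : 0 < betaT δ s L Δ T := by
  unfold betaT
  positivity

lemma betaT_le_one : betaT δ s L Δ T ≤ 1 :=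
  inv_le_one_of_one_le₀ (le_add_of_nonneg_right (Real.sqrt_nonneg _))

lemma inv_betaT : (betaT δ s L Δ T)⁻¹ = 1 + √(δ ^ (3 / 2 : ℝ) * s ^ 2 * T / (L * Δ)) :=
  inv_inv _

lemma le_tauT : 64 / (3 * betaT δ s L Δ T * δ) ≤ (tauT δ s L Δ T : ℝ) := by
  rw [mul_right_comm]
  exact Nat.le_ceil _

variable {δ L}

lemma tauT_pos (hδ : 0 < δ) : 0 < tauT δ s L Δ T :=
  have := betaT_pos δ s L Δ T
  Nat.ceil_pos.2 (by positivity)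

lemma etaT_pos (hL : 0 < L) : 0 < etaT δ s L Δ T := by
  unfold etaT
  positivity

lemma etaT_le (hL : 0 < L) (hδ : 0 < δ) : etaT δ s L Δ T
    ≤ min (min (1 / (4 * L)) √(3 * δ * betaT δ s L Δ T ^ 2 / (80 * L ^ 2)))
      (min √(3 * δ / (80 * (tauT δ s L Δ T : ℝ) ^ 2 * L ^ 2))
        √(3 * betaT δ s L Δ T / (16 * (tauT δ s L Δ T : ℝ) * L ^ 2))) := by
  have := betaT_pos δ s L Δ T
  have : (0 : ℝ) < tauT δ s L Δ T := Nat.cast_pos.2 (tauT_pos s Δ T hδ)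
  have sqrt_div_eq (y z : ℝ) : √(y / z) = (√(z / y))⁻¹ := by rw [← Real.sqrt_inv, inv_div]
  rw [etaT, one_div, sqrt_div_eq (3 * δ * betaT δ s L Δ T ^ 2), sqrt_div_eq (3 * δ),
    sqrt_div_eq (3 * betaT δ s L Δ T)]
  have h₁ : 0 < 4 * L := by positivity
  have h₂ : 0 < √(80 * L ^ 2 / (3 * δ * betaT δ s L Δ T ^ 2)) := by positivity
  have h₃ : 0 < √(80 * (tauT δ s L Δ T : ℝ) ^ 2 * L ^ 2 / (3 * δ)) := by positivity
  have h₄ : 0 < √(16 * (tauT δ s L Δ T : ℝ) * L ^ 2 / (3 * betaT δ s L Δ T)) := by positivity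
  refine le_min (le_min ?_ ?_) (le_min ?_ ?_) <;> exact inv_anti₀ ‹_› (by linarith)

lemma admissible_horizon (hL : 0 < L) (hδ : 0 < δ) (hδ1 : δ ≤ 1) :
    Admissible L δ (betaT δ s L Δ T) (etaT δ s L Δ T) (tauT δ s L Δ T) where
  L_pos := hL
  δ_pos := hδ
  δ_le_one := hδ1
  β_pos := betaT_pos δ s L Δ T
  β_le_one := betaT_le_one δ s L Δ T
  le_period := le_tauT δ s L Δ T
  η_pos := etaT_pos s Δ T hL
  η_le := etaT_le s Δ T hL hδ

end Admissibility

section StepSize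

variable {δ L Δ : ℝ} (s : ℝ) (T : ℕ)

lemma tauT_le_div (hδ : 0 < δ) (hδ1 : δ ≤ 1) :
    (tauT δ s L Δ T : ℝ) ≤ 23 / (δ * betaT δ s L Δ T) := by
  have hβ := betaT_pos δ s L Δ T
  have hone : 1 ≤ 1 / (δ * betaT δ s L Δ T) :=
    (one_le_div (by positivity)).2 (mul_le_one₀ hδ1 hβ.le (betaT_le_one δ s L Δ T))
  calc (tauT δ s L Δ T : ℝ) ≤ 64 / (3 * δ * betaT δ s L Δ T) + 1 :=
        (Nat.ceil_lt_add_one (by positivity)).le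
    _ = 64 / 3 * (1 / (δ * betaT δ s L Δ T)) + 1 := by field_simp
    _ ≤ 23 * (1 / (δ * betaT δ s L Δ T)) := by linarith
    _ = _ := by ring

lemma sqrt_le_div_sqrt_pow_three {b c y : ℝ} (hδ : 0 < δ) (hb : 0 < b) (hc : 0 ≤ c)
    (hy : y ≤ c ^ 2 / (δ ^ 3 * b ^ 2)) : √y ≤ c / (√δ ^ 3 * b) := by
  have hsq : (√δ ^ 3 * b) ^ 2 = δ ^ 3 * b ^ 2 := by
    rw [mul_pow, ← pow_mul, mul_comm 3 2, pow_mul, Real.sq_sqrt hδ.le]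
  exact (Real.sqrt_le_left (by positivity)).2 (by rwa [div_pow, hsq])

lemma sqrt_momentum_term_le {b : ℝ} (hδ : 0 < δ) (hδ1 : δ ≤ 1) (hL : 0 ≤ L) (hb : 0 < b) :
    √(80 * L ^ 2 / (3 * δ * b ^ 2)) ≤ 6 * L / (√δ ^ 3 * b) := by
  have : δ ^ 3 ≤ δ := pow_le_of_le_one hδ.le hδ1 three_ne_zero
  refine sqrt_le_div_sqrt_pow_three hδ hb (by positivity) ?_
  calc 80 * L ^ 2 / (3 * δ * b ^ 2) = 80 / 3 * L ^ 2 / (δ * b ^ 2) := by field_simp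
    _ ≤ 6 ^ 2 * L ^ 2 / (δ ^ 3 * b ^ 2) := by
      gcongr
      norm_num
    _ = _ := by rw [mul_pow]

lemma sqrt_period_term_le {b t : ℝ} (hδ : 0 < δ) (hL : 0 ≤ L) (hb : 0 < b) (ht0 : 0 ≤ t)
    (ht : t ≤ 23 / (δ * b)) : √(80 * t ^ 2 * L ^ 2 / (3 * δ)) ≤ 120 * L / (√δ ^ 3 * b) := by
  refine sqrt_le_div_sqrt_pow_three hδ hb (by positivity) ?_
  calc 80 * t ^ 2 * L ^ 2 / (3 * δ) ≤ 80 * (23 / (δ * b)) ^ 2 * L ^ 2 / (3 * δ) := by gcongr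
    _ = 80 / 3 * 23 ^ 2 * L ^ 2 / (δ ^ 3 * b ^ 2) := by field_simp
    _ ≤ 120 ^ 2 * L ^ 2 / (δ ^ 3 * b ^ 2) := by
      gcongr
      norm_num
    _ = _ := by rw [mul_pow]

lemma sqrt_mixed_term_le {b t : ℝ} (hδ : 0 < δ) (hδ1 : δ ≤ 1) (hL : 0 ≤ L) (hb : 0 < b)
    (ht : t ≤ 23 / (δ * b)) : √(16 * t * L ^ 2 / (3 * b)) ≤ 12 * L / (√δ ^ 3 * b) := by
  have : δ ^ 3 ≤ δ := pow_le_of_le_one hδ.le hδ1 three_ne_zero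
  refine sqrt_le_div_sqrt_pow_three hδ hb (by positivity) ?_
  calc 16 * t * L ^ 2 / (3 * b) ≤ 16 * (23 / (δ * b)) * L ^ 2 / (3 * b) := by gcongr
    _ = 16 / 3 * 23 * L ^ 2 / (δ * b ^ 2) := by field_simp
    _ ≤ 12 ^ 2 * L ^ 2 / (δ ^ 3 * b ^ 2) := by
      gcongr
      norm_num
    _ = _ := by rw [mul_pow]

lemma inv_etaT_le (hδ : 0 < δ) (hδ1 : δ ≤ 1) (hL : 0 < L) :
    (etaT δ s L Δ T)⁻¹ ≤ 142 * L / (√δ ^ 3 * betaT δ s L Δ T) := by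
  have hb := betaT_pos δ s L Δ T
  have hb1 := betaT_le_one δ s L Δ T
  have ht := tauT_le_div (L := L) (Δ := Δ) s T hδ hδ1
  rw [etaT, inv_inv]
  set b := betaT δ s L Δ T
  set t : ℝ := (tauT δ s L Δ T : ℝ)
  have hsmooth : 4 * L ≤ 4 * L / (√δ ^ 3 * b) :=
    le_div_self (by positivity) (by positivity)
      (mul_le_one₀ (pow_le_one₀ (Real.sqrt_nonneg δ) (Real.sqrt_le_one.2 hδ1)) hb.le hb1)
  have hmomentum := sqrt_momentum_term_le hδ hδ1 hL.le hb
  have hperiod := sqrt_period_term_le hδ hL.le hb (Nat.cast_nonneg _) ht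
  have hmixed := sqrt_mixed_term_le hδ hδ1 hL.le hb ht
  calc _ ≤ 4 * L / (√δ ^ 3 * b) + 6 * L / (√δ ^ 3 * b) + 120 * L / (√δ ^ 3 * b)
        + 12 * L / (√δ ^ 3 * b) := by gcongr
    _ = _ := by ring

end StepSize

section Horizon

variable {δ s L Δ ε : ℝ} {T : ℕ}

lemma tauT_le_horizon (hδ : 0 < δ) (hL : 0 < L) (hΔ : 0 < Δ)
    (hT : 2 + 128 / (3 * δ) + (128 * s) ^ 2 / (9 * √δ * L * Δ) ≤ (T : ℝ)) :
    tauT δ s L Δ T ≤ T := by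
  have : 0 < √δ := Real.sqrt_pos.2 hδ
  have hdim : 128 / (3 * δ) ≤ T := by
    linarith [show 0 ≤ (128 * s) ^ 2 / (9 * √δ * L * Δ) by positivity]
  have hnoise : (128 * s) ^ 2 / (9 * √δ * L * Δ) ≤ T := by
    linarith [show 0 ≤ 128 / (3 * δ) by positivity]
  have hroot : √(δ ^ (3 / 2 : ℝ) * s ^ 2 * T / (L * Δ)) ≤ 3 * δ * T / 128 := by
    rw [div_le_iff₀ (by positivity)] at hnoise
    rw [Real.sqrt_le_left (by positivity), rpow_three_half hδ.le, div_le_iff₀ (by positivity)]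
    calc √δ ^ 3 * s ^ 2 * T = (128 * s) ^ 2 * (√δ ^ 3 * T / 128 ^ 2) := by ring
      _ ≤ T * (9 * √δ * L * Δ) * (√δ ^ 3 * T / 128 ^ 2) := by gcongr
      _ = (3 * √δ ^ 2 * T / 128) ^ 2 * (L * Δ) := by ring
      _ = _ := by rw [Real.sq_sqrt hδ.le]
  refine Nat.ceil_le.2 ?_
  calc 64 / (3 * δ * betaT δ s L Δ T) = 64 / (3 * δ) * (betaT δ s L Δ T)⁻¹ := by
        rw [← div_div, div_eq_mul_inv]
    _ ≤ 64 / (3 * δ) * (1 + 3 * δ * T / 128) := by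
        rw [inv_betaT]
        gcongr
    _ = 128 / (3 * δ) / 2 + T / 2 := by
        field_simp
        ring
    _ ≤ T := by linarith

lemma bias_mul_sqrt_eq (hδ : 0 < δ) (hL : 0 < L) (hΔ : 0 < Δ) (hT : 0 < T) :
    L * Δ / (δ ^ (5 / 2 : ℝ) * T) * √(δ ^ (3 / 2 : ℝ) * s ^ 2 * T / (L * Δ))
      = √(L * Δ * s ^ 2 / (δ ^ (7 / 2 : ℝ) * T)) := by
  have : 0 < √δ := Real.sqrt_pos.2 hδ
  rw [rpow_three_half hδ.le, rpow_five_half hδ.le, rpow_seven_half hδ.le,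
    ← Real.sqrt_sq (show 0 ≤ L * Δ / (√δ ^ 5 * T) by positivity),
    ← Real.sqrt_mul (sq_nonneg _)]
  congr 1
  field_simp

lemma sqrt_mul_sqrt_eq_variance (hδ : 0 < δ) (hL : 0 < L) (hΔ : 0 < Δ) (hT : 0 < T) :
    √(L * Δ * s ^ 2 / (δ ^ (7 / 2 : ℝ) * T)) * √(δ ^ (3 / 2 : ℝ) * s ^ 2 * T / (L * Δ))
      = s ^ 2 / δ := by
  have : 0 < √δ := Real.sqrt_pos.2 hδ
  have hsq : L * Δ * s ^ 2 / (√δ ^ 7 * T) * (√δ ^ 3 * s ^ 2 * T / (L * Δ))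
      = (s ^ 2 / √δ ^ 2) ^ 2 := by field_simp
  rw [rpow_three_half hδ.le, rpow_seven_half hδ.le, ← Real.sqrt_mul (by positivity), hsq,
    Real.sqrt_sq (by positivity), Real.sq_sqrt hδ.le]

lemma optimization_term_le (hδ : 0 < δ) (hδ1 : δ ≤ 1) (hL : 0 < L) (hΔ : 0 < Δ) (hT : 0 < T) :
    16 * Δ / (δ * etaT δ s L Δ T * T)
      ≤ 2272 * (L * Δ / (δ ^ (5 / 2 : ℝ) * T) + √(L * Δ * s ^ 2 / (δ ^ (7 / 2 : ℝ) * T))) := by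
  have hη := etaT_pos (δ := δ) s Δ T hL
  have hb := betaT_pos δ s L Δ T
  have : 0 < √δ := Real.sqrt_pos.2 hδ
  have hδ5 : δ * √δ ^ 3 = δ ^ (5 / 2 : ℝ) := by
    rw [rpow_five_half hδ.le, show √δ ^ 5 = √δ ^ 2 * √δ ^ 3 by ring, Real.sq_sqrt hδ.le]
  calc 16 * Δ / (δ * etaT δ s L Δ T * T) = 16 * Δ / (δ * T) * (etaT δ s L Δ T)⁻¹ := by field_simp
    _ ≤ 16 * Δ / (δ * T) * (142 * L / (√δ ^ 3 * betaT δ s L Δ T)) := by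
        gcongr
        exact inv_etaT_le s T hδ hδ1 hL
    _ = 2272 * (L * Δ / (δ * √δ ^ 3 * T) * (betaT δ s L Δ T)⁻¹) := by
        field_simp
        ring
    _ = _ := by rw [hδ5, inv_betaT, mul_one_add, bias_mul_sqrt_eq hδ hL hΔ hT]

lemma noise_term_le (hδ : 0 < δ) (hL : 0 < L) (hΔ : 0 < Δ) (hT : 0 < T) :
    64 * betaT δ s L Δ T * s ^ 2 / (3 * δ)
      ≤ 64 / 3 * √(L * Δ * s ^ 2 / (δ ^ (7 / 2 : ℝ) * T)) := by
  have hroot : √(δ ^ (3 / 2 : ℝ) * s ^ 2 * T / (L * Δ)) * betaT δ s L Δ T ≤ 1 := by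
    rw [betaT, ← div_eq_mul_inv]
    exact div_le_one_of_le₀ (by linarith) (by positivity)
  calc 64 * betaT δ s L Δ T * s ^ 2 / (3 * δ) = 64 / 3 * (s ^ 2 / δ * betaT δ s L Δ T) := by
        field_simp
    _ = 64 / 3 * (√(L * Δ * s ^ 2 / (δ ^ (7 / 2 : ℝ) * T))
          * (√(δ ^ (3 / 2 : ℝ) * s ^ 2 * T / (L * Δ)) * betaT δ s L Δ T)) := by
        rw [← mul_assoc (√_), sqrt_mul_sqrt_eq_variance hδ hL hΔ hT]
    _ ≤ 64 / 3 * √(L * Δ * s ^ 2 / (δ ^ (7 / 2 : ℝ) * T)) := by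
        gcongr
        exact mul_le_of_le_one_right (Real.sqrt_nonneg _) hroot

lemma average_horizon_le {g : ℕ → ℝ} (hg : ∀ t, 0 ≤ g t) {τ : ℕ} (hτ : 0 < τ) (hτT : τ ≤ T)
    {a b : ℝ} (hb : 0 ≤ b) (h : ∀ K : ℕ, 1 ≤ K →
      1 / ((K : ℝ) * τ) * ∑ t ∈ Finset.range (K * τ), g t ≤ a / (K * τ) + b) :
    1 / (T : ℝ) * ∑ t ∈ Finset.range T, g t ≤ a / T + 2 * b := by
  have hT : (0 : ℝ) < T := Nat.cast_pos.2 (hτ.trans_le hτT)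
  obtain ⟨K, hK, hTK, hKT⟩ : ∃ K : ℕ, 1 ≤ K ∧ T ≤ K * τ ∧ K * τ ≤ 2 * T := by
    have hdiv := Nat.div_add_mod' T τ
    have hmod := Nat.mod_lt T hτ
    refine ⟨T / τ + 1, Nat.le_add_left _ _, ?_, ?_⟩ <;>
    · rw [add_mul]
      lia
  have hKτ : (0 : ℝ) < K * τ := mul_pos (Nat.cast_pos.2 hK) (Nat.cast_pos.2 hτ)
  have hperiods := h K hK
  rw [one_div_mul_eq_div, div_le_iff₀ hKτ, add_mul, div_mul_cancel₀ _ hKτ.ne'] at hperiods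
  rw [one_div_mul_eq_div, div_le_iff₀ hT]
  calc ∑ t ∈ Finset.range T, g t ≤ ∑ t ∈ Finset.range (K * τ), g t :=
        Finset.sum_le_sum_of_subset_of_nonneg (Finset.range_subset_range.2 hTK) fun t _ _ => hg t
    _ ≤ a + b * (K * τ) := hperiods
    _ ≤ a + b * (2 * T) := by
        gcongr a + b * ?_
        exact_mod_cast hKT
    _ = (a / T + 2 * b) * T := by
        field_simp

lemma bias_term_le_of_horizon (hδ : 0 < δ) (hε : 0 < ε) {c : ℝ} (hc : 0 < c) (hT : 0 < T)
    (hcT : c * (L * Δ / (δ ^ (5 / 2 : ℝ) * ε)) ≤ T) :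
    L * Δ / (δ ^ (5 / 2 : ℝ) * T) ≤ ε / c := by
  have : 0 < δ ^ (5 / 2 : ℝ) := Real.rpow_pos_of_pos hδ _
  rw [div_le_div_iff₀ (by positivity) hc]
  rw [← mul_div_assoc, div_le_iff₀ (by positivity)] at hcT
  linarith

lemma noise_term_le_of_horizon (hδ : 0 < δ) (hε : 0 < ε) {c : ℝ} (hc : 0 < c) (hT : 0 < T)
    (hcT : c ^ 2 * (L * Δ * s ^ 2 / (δ ^ (7 / 2 : ℝ) * ε ^ 2)) ≤ T) :
    √(L * Δ * s ^ 2 / (δ ^ (7 / 2 : ℝ) * T)) ≤ ε / c := by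
  have : 0 < δ ^ (7 / 2 : ℝ) := Real.rpow_pos_of_pos hδ _
  rw [Real.sqrt_le_left (by positivity), div_pow, div_le_div_iff₀ (by positivity) (by positivity)]
  rw [← mul_div_assoc, div_le_iff₀ (by positivity)] at hcT
  linarith

lemma exists_horizon (hδ : 0 < δ) (hδ1 : δ ≤ 1) (hL : 0 < L) (hΔ : 0 < Δ) (hε : 0 < ε) :
    ∃ T₀ : ℕ, (T₀ : ℝ) ≤ 22000000 * (L * Δ * s ^ 2 / (δ ^ (7 / 2 : ℝ) * ε ^ 2)
        + L * Δ / (δ ^ (5 / 2 : ℝ) * ε) + s ^ 2 / (√δ * L * Δ) + 1 / δ) ∧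
      ∀ T : ℕ, T₀ ≤ T →
        2 + 128 / (3 * δ) + (128 * s) ^ 2 / (9 * √δ * L * Δ) ≤ (T : ℝ) ∧
        2300 * (L * Δ / (δ ^ (5 / 2 : ℝ) * T) + √(L * Δ * s ^ 2 / (δ ^ (7 / 2 : ℝ) * T))) ≤ ε := by
  have hnoise : (128 * s) ^ 2 / (9 * √δ * L * Δ) = 128 ^ 2 / 9 * (s ^ 2 / (√δ * L * Δ)) := by
    field_simp
  have hdim : 128 / (3 * δ) = 128 / 3 * (1 / δ) := by field_simp
  rw [hnoise, hdim]
  set a := L * Δ * s ^ 2 / (δ ^ (7 / 2 : ℝ) * ε ^ 2)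
  set b := L * Δ / (δ ^ (5 / 2 : ℝ) * ε)
  set c := s ^ 2 / (√δ * L * Δ)
  set d := 1 / δ
  have ha : 0 ≤ a := by positivity
  have hb : 0 ≤ b := by positivity
  have hc : 0 ≤ c := by positivity
  have hd : 1 ≤ d := (one_le_div hδ).2 hδ1
  refine ⟨⌈2 + 128 / 3 * d + 128 ^ 2 / 9 * c + 4600 * b + 4600 ^ 2 * a⌉₊, ?_, fun T hT => ?_⟩
  · exact (Nat.ceil_lt_add_one (by positivity)).le.trans (by linarith)
  · have hceil := Nat.ceil_le.1 hT
    have hT0 : 0 < T := (Nat.cast_pos (α := ℝ)).1 (by linarith)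
    have hbT : 4600 * b ≤ T := by linarith
    have haT : 4600 ^ 2 * a ≤ T := by linarith
    have hbias := bias_term_le_of_horizon hδ hε (by norm_num) hT0 hbT
    have hsqrt := noise_term_le_of_horizon hδ hε (by norm_num) hT0 haT
    exact ⟨by linarith, by linarith⟩

end Horizon

/-! ### Convergence rates -/

namespace ProjectedMomentum

variable {E Ω : Type*} [NormedAddCommGroup E] [InnerProductSpace ℝ E] [CompleteSpace E]
  [MeasurableSpace E] [BorelSpace E] [SecondCountableTopology E] [MeasurableSpace Ω]
  {μ : Measure Ω} [IsProbabilityMeasure μ] {f : E → ℝ} {L δ β η s : ℝ} {x₀ : E}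
  {x M ν : ℕ → Ω → E} {A : ℕ → Ω → E →ₗ[ℝ] E}

lemma average_gradient_sq_le {τ K : ℕ} (h : ProjectedMomentum μ f L δ β η s τ x₀ x M ν A)
    (ha : Admissible L δ β η τ) (hK : 1 ≤ K) :
    1 / ((K : ℝ) * τ) * ∑ t ∈ Finset.range (K * τ), ∫ ω, ‖gradient f (x t ω)‖ ^ 2 ∂μ
      ≤ 16 * (f x₀ - ⨅ y, f y) / (δ * η * K * τ) + 32 * β * s ^ 2 / (3 * δ) := by
  have := ha.δ_pos
  have := ha.η_pos
  refine ((h.scalarRecursion ha).average_le ha hK).trans ?_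
  gcongr 16 * ?_ / _ + _
  exact h.integral_loss_zero_sub_le _

lemma average_gradient_sq_le_of_horizon {Δ : ℝ} {T : ℕ}
    (h : ProjectedMomentum μ f L δ (betaT δ s L Δ T) (etaT δ s L Δ T) s (tauT δ s L Δ T)
      x₀ x M ν A)
    (hδ : 0 < δ) (hδ1 : δ ≤ 1) (hL : 0 < L) (hgap : f x₀ - ⨅ y, f y = Δ) (hΔ : 0 < Δ)
    (hT : 2 + 128 / (3 * δ) + (128 * s) ^ 2 / (9 * √δ * L * Δ) ≤ (T : ℝ)) :
    1 / (T : ℝ) * ∑ t ∈ Finset.range T, ∫ ω, ‖gradient f (x t ω)‖ ^ 2 ∂μ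
      ≤ 2300 * (L * Δ / (δ ^ (5 / 2 : ℝ) * T) + √(L * Δ * s ^ 2 / (δ ^ (7 / 2 : ℝ) * T))) := by
  have hβ := betaT_pos δ s L Δ T
  have hτ := tauT_pos (L := L) s Δ T hδ
  have hτT := tauT_le_horizon hδ hL hΔ hT
  have hT0 : 0 < T := hτ.trans_le hτT
  have hbias : 0 ≤ L * Δ / (δ ^ (5 / 2 : ℝ) * T) := by positivity
  have hnoise := noise_term_le (s := s) hδ hL hΔ hT0
  set R := √(L * Δ * s ^ 2 / (δ ^ (7 / 2 : ℝ) * T))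
  have hR : 0 ≤ R := Real.sqrt_nonneg _
  calc _ ≤ 16 * Δ / (δ * etaT δ s L Δ T) / T
        + 2 * (32 * betaT δ s L Δ T * s ^ 2 / (3 * δ)) := by
        refine average_horizon_le (fun t => integral_nonneg fun _ => by positivity) hτ hτT
          (by positivity) fun K hK => ?_
        rw [div_div, ← mul_assoc]
        exact hgap ▸ h.average_gradient_sq_le (admissible_horizon s Δ T hL hδ hδ1) hK
    _ = 16 * Δ / (δ * etaT δ s L Δ T * T) + 64 * betaT δ s L Δ T * s ^ 2 / (3 * δ) := by
        rw [div_div]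
        ring
    _ ≤ 2272 * (L * Δ / (δ ^ (5 / 2 : ℝ) * T) + R) + 64 / 3 * R :=
        add_le_add (optimization_term_le hδ hδ1 hL hΔ hT0) hnoise
    _ ≤ _ := by linarith

end ProjectedMomentum

end GoLore

theorem theorem4 :
    ∃ C : ℝ, 0 < C ∧
    ∀ (N : ℕ) (m n r : Fin N → ℕ) (Ξ Ω : Type*) [MeasurableSpace Ξ] [MeasurableSpace Ω]
      (D : Measure Ξ) [IsProbabilityMeasure D] (μ : Measure Ω) [IsProbabilityMeasure μ]
      (F : Params m n → Ξ → ℝ) (L : ℝ) (σ : Fin N → ℝ) (x₀ : Params m n)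
      (ξ : ℕ → Ω → Ξ)
      (P : ℕ → ∀ ℓ, Ω → Matrix (Fin (m ℓ)) (Fin (r ℓ)) ℝ)
      (Q : ℕ → ∀ ℓ, Ω → Matrix (Fin (n ℓ)) (Fin (r ℓ)) ℝ)
      (f : Params m n → ℝ) (δ s Δ : ℝ),
      0 < N → (∀ ℓ, 1 ≤ r ℓ ∧ r ℓ ≤ m ℓ ∧ r ℓ ≤ n ℓ) →
      0 < L → (∀ ℓ, 0 ≤ σ ℓ) →
      f = objective F D → δ = minDelta m n r → s = totalSigma σ → Δ = gap f x₀ →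
      BddBelow (Set.range f) → LSmooth f L → StochasticGradient F D σ →
      Sampling μ D ξ P Q →
      -- the bound over `K` periods, for all admissible hyperparameters
      (∀ (β η : ℝ) (τ K : ℕ), 0 < β → β ≤ 1 → 64 / (3 * β * δ) ≤ (τ : ℝ) →
        0 < η →
        η ≤ min (min (1 / (4 * L)) √(3 * δ * β ^ 2 / (80 * L ^ 2)))
          (min √(3 * δ / (80 * (τ : ℝ) ^ 2 * L ^ 2)) √(3 * β / (16 * (τ : ℝ) * L ^ 2))) →
        1 ≤ K →
        (∀ t, Integrable (fun ω => ‖gradient f (iterate F β η τ x₀ ξ P Q t ω)‖ ^ 2) μ) ∧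
        1 / ((K : ℝ) * τ) * ∑ t ∈ Finset.range (K * τ),
            ∫ ω, ‖gradient f (iterate F β η τ x₀ ξ P Q t ω)‖ ^ 2 ∂μ
          ≤ 16 * Δ / (δ * η * K * τ) + 32 * β * s ^ 2 / (3 * δ)) ∧
      -- the rate over `T` iterations, for the chosen hyperparameters
      (0 < Δ → ∀ T : ℕ,
        2 + 128 / (3 * δ) + (128 * s) ^ 2 / (9 * √δ * L * Δ) ≤ (T : ℝ) →
        (∀ t, Integrable (fun ω => ‖gradient f (iterate F (betaT δ s L Δ T) (etaT δ s L Δ T)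
            (tauT δ s L Δ T) x₀ ξ P Q t ω)‖ ^ 2) μ) ∧
        1 / (T : ℝ) * ∑ t ∈ Finset.range T,
            ∫ ω, ‖gradient f (iterate F (betaT δ s L Δ T) (etaT δ s L Δ T)
              (tauT δ s L Δ T) x₀ ξ P Q t ω)‖ ^ 2 ∂μ
          ≤ C * (L * Δ / (δ ^ (5 / 2 : ℝ) * T)
              + √(L * Δ * s ^ 2 / (δ ^ (7 / 2 : ℝ) * T)))) ∧
      -- the resulting number of iterations (one stochastic gradient each) for accuracy `ε`
      (0 < Δ → ∀ ε : ℝ, 0 < ε → ∃ T₀ : ℕ,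
        (T₀ : ℝ) ≤ C * (L * Δ * s ^ 2 / (δ ^ (7 / 2 : ℝ) * ε ^ 2)
          + L * Δ / (δ ^ (5 / 2 : ℝ) * ε) + s ^ 2 / (√δ * L * Δ) + 1 / δ) ∧
        ∀ T : ℕ, T₀ ≤ T →
          2 + 128 / (3 * δ) + (128 * s) ^ 2 / (9 * √δ * L * Δ) ≤ (T : ℝ) ∧
          1 / (T : ℝ) * ∑ t ∈ Finset.range T,
              ∫ ω, ‖gradient f (iterate F (betaT δ s L Δ T) (etaT δ s L Δ T)
                (tauT δ s L Δ T) x₀ ξ P Q t ω)‖ ^ 2 ∂μ ≤ ε) := by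
  refine ⟨22000000, by norm_num, ?_⟩
  intro N m n r Ξ Ω _ _ D _ μ _ F L σ x₀ ξ P Q f δ s Δ hN hr hL _ hf hδ hs hΔ hbdd hsmooth hG hS
  subst hf hs
  have : Nonempty (Fin N) := ⟨⟨0, hN⟩⟩
  have hpos : 0 < δ := hδ ▸ minDelta_pos hr
  have hle : δ ≤ 1 := hδ ▸ minDelta_le_one fun ℓ => (hr ℓ).2
  have hrun (β η : ℝ) (τ : ℕ) :=
    hδ ▸ hS.projectedMomentum hG β η τ x₀ (fun ℓ => (hr ℓ).2) hbdd hsmooth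
  have hrate := fun (hΔ₀ : 0 < Δ) T hT =>
    (hrun _ _ _).average_gradient_sq_le_of_horizon (T := T) hpos hle hL hΔ.symm hΔ₀ hT
  have hintegrable := fun β η τ t =>
    integrable_norm_sq_of_memLp_two ((hrun β η τ).memLp_gradient t)
  refine ⟨fun β η τ K hβ hβ1 hτ hη hη' hK => ⟨hintegrable β η τ, ?_⟩,
    fun hΔ₀ T hT => ⟨hintegrable _ _ _, (hrate hΔ₀ T hT).trans ?_⟩, fun hΔ₀ ε hε => ?_⟩
  · rw [hΔ]
    exact (hrun β η τ).average_gradient_sq_le ⟨hL, hpos, hle, hβ, hβ1, hτ, hη, hη'⟩ hK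
  · gcongr
    norm_num
  · obtain ⟨T₀, hT₀, hT⟩ := exists_horizon (s := totalSigma σ) hpos hle hL hΔ₀ hε
    exact ⟨T₀, hT₀, fun T hTT => ⟨(hT T hTT).1, (hrate hΔ₀ T (hT T hTT).1).trans (hT T hTT).2⟩⟩
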